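/- Let $(X_n)_{n\ge 1}$ be a strictly stationary sequence of associated real random variables on a probability space, i.e. for every finite subcollection $X_{i_1},\dots,X_{i_m}$ and all coordinatewise nondecreasing $g,h:\mathbb R^m\to\mathbb R$ one has $\mathrm{Cov}\big(g(X_{i_1},\dots,X_{i_m}),h(X_{i_1},\dots,X_{i_m})\big)\ge 0$ whenever this covariance is defined. Let $F$ be the distribution function of $X_1$, and suppose that $X_1$ has a bounded Lebesgue density $f$. Let $0<p<1$, let $\xi_p=\inf\{x: F(x)\ge p\}$ be the $p$-th quantile of $F$, and suppose that $F$ is differentiable at $\xi_p$ with $F'(\xi_p)=f(\xi_p)>0$. Let $F_n(x)=\frac1n\sum_{i=1}^n \mathbf 1_{\{X_i\le x\}}$ be the empirical distribution function and $\xi_{n,p}=\inf\{x: F_n(x)\ge p\}$ the $p$-th sample quantile. Assume that there are constants $b>3$ and $b_0\ge 0$ such that, for all $k\ge 1$, the covariance of $X_1$ and $X_{k+1}$ is defined and $$\mathrm{Cov}(X_1,X_{k+1})\le b_0\,k^{-b}.$$ Then, for every $\delta>\frac{3}{2b}$, $$|\xi_{n,p}-\xi_p| = O_{a.s.}\big(n^{-1/2}\log^{\delta}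 n\big)\qquad (n\to\infty),$$ that is, almost surely the ratio $|\xi_{n,p}-\xi_p|/(n^{-1/2}\log^\delta n)$, $n\ge 2$, is bounded. -/

import Mathlib

open MeasureTheory ProbabilityTheory Filter Asymptotics

/-- The covariance of `Y` and `Z` is defined: `Y`, `Z` and `Y Z` have finite expectations. -/
def CovDefined {Ω : Type*} [MeasurableSpace Ω] (Y Z : Ω → ℝ) (P : Measure Ω) : Prop :=
  Integrable Y P ∧ Integrable Z P ∧ Integrable (fun ω => Y ω * Z ω) P

/-- Association: for every finite subcollection and all coordinatewise nondecreasing `g`, `h`,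
the covariance of `g` and `h` of the subcollection is nonnegative whenever it is defined.
(The order on `I → ℝ` is the coordinatewise one.) -/
def AssociatedSeq {Ω : Type*} [MeasurableSpace Ω] (X : ℕ → Ω → ℝ) (P : Measure Ω) : Prop :=
  ∀ (I : Finset ℕ) (g h : (I → ℝ) → ℝ), Monotone g → Monotone h →
    CovDefined (fun ω => g (fun i => X i ω)) (fun ω => h (fun i => X i ω)) P →
    0 ≤ covariance (fun ω => g (fun i => X i ω)) (fun ω => h (fun i => X i ω)) P

/-- Strict stationarity: all shifts of the sequence have the same law on `ℕ → ℝ`. -/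
def StrictlyStationary {Ω : Type*} [MeasurableSpace Ω] (X : ℕ → Ω → ℝ) (P : Measure Ω) : Prop :=
  ∀ k : ℕ, IdentDistrib (fun ω (i : ℕ) => X (i + k) ω) (fun ω (i : ℕ) => X i ω) P P

/-- `f` is a (nonnegative, measurable) Lebesgue density of the law `ν`. -/
def IsDensity (f : ℝ → ℝ) (ν : Measure ℝ) : Prop :=
  Measurable f ∧ (∀ x, 0 ≤ f x) ∧ ν = volume.withDensity (fun x => ENNReal.ofReal (f x))

/-- The `p`-quantile `inf {x : G x ≥ p}` of a distribution function `G`. -/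
noncomputable def quantile (G : ℝ → ℝ) (p : ℝ) : ℝ :=
  sInf {x : ℝ | p ≤ G x}

/-- The distribution function of a real random variable `Y`. -/
noncomputable def distFun {Ω : Type*} [MeasurableSpace Ω] (Y : Ω → ℝ) (P : Measure Ω) : ℝ → ℝ :=
  fun x => P.real {ω | Y ω ≤ x}

/-- The empirical distribution function of the first `n` terms `X 0, …, X (n - 1)`. -/
noncomputable def empDistFun {Ω : Type*} (X : ℕ → Ω → ℝ) (n : ℕ) (ω : Ω) : ℝ → ℝ :=
  fun x => (1 / (n : ℝ)) * ∑ i ∈ Finset.range n, Set.indicator {y : ℝ | y ≤ x} 1 (X i ω)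

/-- Polynomial covariance decay with exponent `b`. The sequence starts at index `0`, so `X 0` is
the first term and `X k` is the `(k + 1)`-st. -/
def CovDecay {Ω : Type*} [MeasurableSpace Ω] (X : ℕ → Ω → ℝ) (P : Measure Ω) (b : ℝ) : Prop :=
  ∃ b₀ : ℝ, 0 ≤ b₀ ∧ ∀ k : ℕ, 1 ≤ k →
    CovDefined (X 0) (X k) P ∧ covariance (X 0) (X k) P ≤ b₀ * (k : ℝ) ^ (-b)

/-- `Z n = O_{a.s.}(r n)`: almost surely, `Z n / r n` stays bounded. -/
def IsBigOAS {Ω : Type*} [MeasurableSpace Ω] (Z : ℕ → Ω → ℝ) (r : ℕ → ℝ) (P : Measure Ω) : Prop :=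
  ∀ᵐ ω ∂P, (fun n => Z n ω) =O[atTop] r

/-! The sample quantile lies within `r` of `ξ` as soon as `F_n (ξ - r) < p ≤ F_n (ξ + r)`. For small
`r`, `F` moves by at least `f ξ * r / 2` on either side of `ξ`, so a failure forces a sum of `n`
centred indicators at the level `ξ + r` or `ξ - r` to deviate by order `n r`. Take `r_j = j ^ δ /
√(2 ^ j)` for `2 ^ (j - 1) ≤ n < 2 ^ j`. By Borel–Cantelli it suffices that the maximal partial sums
up to `2 ^ j` exceed a multiple of `j ^ δ * √(2 ^ j)` with probabilities summable in `j`.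

The indicators `1 {X > x}` are increasing in `X`, hence associated. Replacing them by ramps of width
`ε` bounds their covariance at lag `k` by `Cov (X_0, X_k) / ε ^ 2 + 2 M ε`. The choice `ε = k ^ (-b
/ 3)` gives a bound of order `k ^ (-b / 3)`, uniform in `x` and summable because `b > 3`
(`exists_isWeaklyCorrelated_indicator`).

Association reduces the maximum of the partial sums to the last one
(`measureReal_maxPartialSum_ge_le`). For the tail of that sum, cut it into blocks. If `B'` has the
law of `B` and is independent of `A`, then `E g (A + B) ≤ E g (A + B') + K * Cov (A, B)` whenever `K
x - g' x` is nondecreasing, because `K x ^ 2 / 2 - g` is then convex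
(`AssociatedSeq.integral_comp_add_le`). A smooth step `g` below an exponential combines two
advantages: its curvature is only of order `1 / T ^ 2`, and the independent part obeys a Chernoff
bound. Blocks of length about `2 ^ (j / 3)` yield terms `exp (-c j ^ δ)` and `2 ^ (-s j / 3)`, up to
constants, summable for every `δ > 0` (`IsWeaklyCorrelated.exists_summable_bound`). -/

/-- `U` is a coordinatewise nondecreasing function of finitely many terms of `X`. -/
def IncrOf {Ω : Type*} (X : ℕ → Ω → ℝ) (U : Ω → ℝ) : Prop :=
  ∃ (I : Finset ℕ) (g : (I → ℝ) → ℝ), Monotone g ∧ ∀ ω, U ω = g (fun i => X i ω)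

/-! ### Increasing functions of finitely many terms -/

section IncrOf

variable {Ω : Type*} {X : ℕ → Ω → ℝ} {U V : Ω → ℝ}

/-- A nondecreasing function of finitely many terms may be viewed as a function of more terms. -/
theorem exists_monotone_of_subset {I J : Finset ℕ} (hIJ : I ⊆ J) {g : (I → ℝ) → ℝ}
    (hg : Monotone g) :
    ∃ h : (J → ℝ) → ℝ, Monotone h ∧
      ∀ ω, h (fun i => X i ω) = g (fun i => X i ω) :=
  ⟨fun v => g (fun i => v ⟨i, hIJ i.2⟩), fun _ _ hvw => hg fun i => hvw ⟨i, hIJ i.2⟩,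
    fun _ => rfl⟩

theorem IncrOf.exists_common (hU : IncrOf X U) (hV : IncrOf X V) :
    ∃ (I : Finset ℕ) (g h : (I → ℝ) → ℝ), Monotone g ∧ Monotone h ∧
      (∀ ω, U ω = g (fun i => X i ω)) ∧ ∀ ω, V ω = h (fun i => X i ω) := by
  obtain ⟨I, g, hg, hgU⟩ := hU
  obtain ⟨J, h, hh, hhV⟩ := hV
  obtain ⟨g', hg', e⟩ := exists_monotone_of_subset (X := X) (Finset.subset_union_left (s₂ := J)) hg
  obtain ⟨h', hh', e'⟩ :=
    exists_monotone_of_subset (X := X) (Finset.subset_union_right (s₁ := I)) hh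
  exact ⟨I ∪ J, g', h', hg', hh', fun ω => by rw [hgU, e], fun ω => by rw [hhV, e']⟩

theorem IncrOf.coord (X : ℕ → Ω → ℝ) (i : ℕ) : IncrOf X (X i) :=
  ⟨{i}, fun v => v ⟨i, Finset.mem_singleton_self i⟩, fun _ _ h => h _, fun _ => rfl⟩

theorem IncrOf.const (X : ℕ → Ω → ℝ) (c : ℝ) : IncrOf X (fun _ => c) :=
  ⟨∅, fun _ => c, monotone_const, fun _ => rfl⟩

theorem IncrOf.comp {φ : ℝ → ℝ} (hφ : Monotone φ) (hU : IncrOf X U) :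
    IncrOf X (fun ω => φ (U ω)) := by
  obtain ⟨I, g, hg, e⟩ := hU
  exact ⟨I, fun v => φ (g v), hφ.comp hg, fun ω => congrArg φ (e ω)⟩

theorem IncrOf.comp₂ {φ : ℝ → ℝ → ℝ} (hφ : ∀ a b c d, a ≤ b → c ≤ d → φ a c ≤ φ b d)
    (hU : IncrOf X U) (hV : IncrOf X V) : IncrOf X (fun ω => φ (U ω) (V ω)) := by
  obtain ⟨I, g, h, hg, hh, e, e'⟩ := hU.exists_common hV
  exact ⟨I, fun v => φ (g v) (h v), fun v w hvw => hφ _ _ _ _ (hg hvw) (hh hvw),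
    fun ω => congrArg₂ φ (e ω) (e' ω)⟩

theorem IncrOf.add (hU : IncrOf X U) (hV : IncrOf X V) : IncrOf X (fun ω => U ω + V ω) :=
  IncrOf.comp₂ (φ := fun a b => a + b) (fun _ _ _ _ h h' => add_le_add h h') hU hV

theorem IncrOf.max (hU : IncrOf X U) (hV : IncrOf X V) :
    IncrOf X (fun ω => Max.max (U ω) (V ω)) :=
  IncrOf.comp₂ (φ := fun a b => Max.max a b) (fun _ _ _ _ h h' => max_le_max h h') hU hV

theorem IncrOf.min (hU : IncrOf X U) (hV : IncrOf X V) :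
    IncrOf X (fun ω => Min.min (U ω) (V ω)) :=
  IncrOf.comp₂ (φ := fun a b => Min.min a b) (fun _ _ _ _ h h' => min_le_min h h') hU hV

theorem IncrOf.sum {ι : Type*} (s : Finset ι) (W : ι → Ω → ℝ) (h : ∀ i ∈ s, IncrOf X (W i)) :
    IncrOf X (fun ω => ∑ i ∈ s, W i ω) := by
  classical
  induction s using Finset.induction_on with
  | empty => simpa using IncrOf.const X 0
  | insert i s hi ih =>
    simp only [Finset.sum_insert hi]
    exact (h i (Finset.mem_insert_self i s)).add
      (ih fun k hk => h k (Finset.mem_insert_of_mem hk))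

theorem IncrOf.trans {Y : ℕ → Ω → ℝ} (hY : ∀ i, IncrOf X (Y i)) (hU : IncrOf Y U) :
    IncrOf X U := by
  obtain ⟨I, g, hg, e⟩ := hU
  choose J h hh e' using hY
  refine ⟨I.biUnion J, fun v => g (fun i => h i fun k =>
    v ⟨k, Finset.mem_biUnion.2 ⟨i, i.2, k.2⟩⟩), fun v w hvw => hg fun i => hh i fun k => hvw _,
    fun ω => ?_⟩
  rw [e]
  congr 1
  ext i
  rw [e']

end IncrOf

/-! ### Consequences of association -/

section Associated

variable {Ω : Type*} [MeasurableSpace Ω] {P : Measure Ω} [IsProbabilityMeasure P]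
  {X : ℕ → Ω → ℝ} {U V : Ω → ℝ}

theorem covariance_eq_integral_mul_sub (h : CovDefined U V P) :
    covariance U V P = ∫ ω, U ω * V ω ∂P - (∫ ω, U ω ∂P) * ∫ ω, V ω ∂P := by
  obtain ⟨hU, hV, hUV⟩ := h
  have e : ∀ ω, (U ω - ∫ ω, U ω ∂P) * (V ω - ∫ ω, V ω ∂P) =
      U ω * V ω - U ω * (∫ ω, V ω ∂P) - (∫ ω, U ω ∂P) * V ω
        + (∫ ω, U ω ∂P) * ∫ ω, V ω ∂P := fun ω => by ring
  have h1 : Integrable (fun ω => U ω * (∫ ω, V ω ∂P)) P := hU.mul_const _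
  have h2 : Integrable (fun ω => (∫ ω, U ω ∂P) * V ω) P := hV.const_mul _
  unfold covariance
  simp_rw [e]
  have h3 : Integrable (fun ω => U ω * V ω - U ω * (∫ ω, V ω ∂P)) P := hUV.sub h1
  have h4 : Integrable
      (fun ω => U ω * V ω - U ω * (∫ ω, V ω ∂P) - (∫ ω, U ω ∂P) * V ω) P := h3.sub h2
  rw [integral_add h4 (integrable_const _), integral_sub h3 h2,
    integral_sub hUV h1, integral_mul_const, integral_const_mul]
  simp

theorem AssociatedSeq.integral_mul_integral_le (hX : AssociatedSeq X P) (hU : IncrOf X U)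
    (hV : IncrOf X V) (iU : Integrable U P) (iV : Integrable V P)
    (iUV : Integrable (fun ω => U ω * V ω) P) :
    (∫ ω, U ω ∂P) * ∫ ω, V ω ∂P ≤ ∫ ω, U ω * V ω ∂P := by
  obtain ⟨I, g, h, hg, hh, e, e'⟩ := hU.exists_common hV
  obtain rfl : U = fun ω => g (fun i => X i ω) := funext e
  obtain rfl : V = fun ω => h (fun i => X i ω) := funext e'
  have := hX I g h hg hh ⟨iU, iV, iUV⟩
  rw [covariance_eq_integral_mul_sub ⟨iU, iV, iUV⟩] at this
  linarith

/-- Carries association from `X` to the centred indicators, and from a sequence to its shifts. -/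
theorem AssociatedSeq.of_incrOf (hX : AssociatedSeq X P) {Y : ℕ → Ω → ℝ}
    (hY : ∀ i, IncrOf X (Y i)) : AssociatedSeq Y P := by
  intro I g h hg hh hd
  have h1 : IncrOf X (fun ω => g (fun i : I => Y i ω)) :=
    IncrOf.trans hY ⟨I, g, hg, fun _ => rfl⟩
  have h2 : IncrOf X (fun ω => h (fun i : I => Y i ω)) :=
    IncrOf.trans hY ⟨I, h, hh, fun _ => rfl⟩
  have := hX.integral_mul_integral_le h1 h2 hd.1 hd.2.1 hd.2.2
  rw [covariance_eq_integral_mul_sub hd]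
  linarith

/-- If `g` is nondecreasing, so is `v ↦ -g (-v)`, and the two outer signs cancel in the covariance.
This serves the deviations below `ξ`. -/
theorem AssociatedSeq.neg (hX : AssociatedSeq X P) : AssociatedSeq (fun i ω => -X i ω) P := by
  intro I g h hg hh hd
  have hd' : CovDefined (fun ω => -g (fun i : I => -X i ω)) (fun ω => -h (fun i : I => -X i ω)) P :=
    ⟨hd.1.neg, hd.2.1.neg, by simpa using hd.2.2⟩
  have := hX I (fun v => -g (fun i => -v i)) (fun v => -h (fun i => -v i))
    (fun v w hvw => neg_le_neg (hg fun i => neg_le_neg (hvw i)))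
    (fun v w hvw => neg_le_neg (hh fun i => neg_le_neg (hvw i))) hd'
  rw [covariance_eq_integral_mul_sub hd'] at this
  rw [covariance_eq_integral_mul_sub hd]
  simpa [integral_neg] using this

/-- A measurable function bounded by a constant is integrable for a probability measure. -/
theorem integrable_of_abs_le (hU : Measurable U) {R : ℝ} (hR : ∀ ω, |U ω| ≤ R) :
    Integrable U P :=
  Integrable.of_bound hU.aestronglyMeasurable R (ae_of_all _ hR)

theorem AssociatedSeq.integral_mul_integral_le_of_bdd (hX : AssociatedSeq X P) (hU : IncrOf X U)
    (hV : IncrOf X V) (mU : Measurable U) (mV : Measurable V) {R R' : ℝ}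
    (bU : ∀ ω, |U ω| ≤ R) (bV : ∀ ω, |V ω| ≤ R') :
    (∫ ω, U ω ∂P) * ∫ ω, V ω ∂P ≤ ∫ ω, U ω * V ω ∂P :=
  hX.integral_mul_integral_le hU hV (integrable_of_abs_le mU bU) (integrable_of_abs_le mV bV)
    (integrable_of_abs_le (R := R * R') (mU.mul mV) fun ω => by
      rw [abs_mul]
      exact mul_le_mul (bU ω) (bV ω) (abs_nonneg _) ((abs_nonneg _).trans (bU ω)))

end Associated

/-- `max (0, Y a, Y a + Y (a + 1), …, Y a + ⋯ + Y (a + n - 1))`. -/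
noncomputable def maxPartialSum {Ω : Type*} (Y : ℕ → Ω → ℝ) : ℕ → ℕ → Ω → ℝ
  | 0, _ => fun _ => 0
  | n + 1, a => fun ω => max 0 (Y a ω + maxPartialSum Y n (a + 1) ω)

/-! ### Maximal inequality for partial sums -/

section MaximalInequality

variable {Ω : Type*} {Y : ℕ → Ω → ℝ}

theorem sum_range_succ_shift (Y : ℕ → Ω → ℝ) (n a : ℕ) (ω : Ω) :
    ∑ i ∈ Finset.range (n + 1), Y (a + i) ω =
      Y a ω + ∑ i ∈ Finset.range n, Y (a + 1 + i) ω := by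
  rw [Finset.sum_range_succ', add_comm]
  simp only [add_zero, add_right_inj]
  exact Finset.sum_congr rfl fun i _ => by rw [add_right_comm, add_assoc]

theorem maxPartialSum_nonneg (n a : ℕ) (ω : Ω) : 0 ≤ maxPartialSum Y n a ω := by
  cases n with
  | zero => exact le_rfl
  | succ n => exact le_max_left _ _

theorem sum_le_maxPartialSum (n : ℕ) : ∀ (a k : ℕ), k ≤ n → ∀ ω,
    ∑ i ∈ Finset.range k, Y (a + i) ω ≤ maxPartialSum Y n a ω := by
  induction n with
  | zero =>
    intro a k hk ω
    obtain rfl : k = 0 := by omega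
    simp [maxPartialSum]
  | succ n ih =>
    intro a k hk ω
    cases k with
    | zero => simpa using maxPartialSum_nonneg (n + 1) a ω
    | succ k =>
      rw [sum_range_succ_shift]
      exact (add_le_add_right (ih (a + 1) k (by omega) ω) _).trans (le_max_right _ _)

theorem incrOf_maxPartialSum (n : ℕ) : ∀ a, IncrOf Y (maxPartialSum Y n a) := by
  induction n with
  | zero => exact fun a => IncrOf.const Y 0
  | succ n ih => exact fun a => (IncrOf.const Y 0).max ((IncrOf.coord Y a).add (ih (a + 1)))

/-- The last sum minus the maximum is the minimum, over `k ≤ n`, of the sums of the terms from `a +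
k` on. Hence the maximum and its difference from the last sum are both increasing, which is what the
maximal inequality exploits. -/
theorem incrOf_sum_sub_maxPartialSum (n : ℕ) : ∀ a,
    IncrOf Y (fun ω => ∑ i ∈ Finset.range n, Y (a + i) ω - maxPartialSum Y n a ω) := by
  induction n with
  | zero => exact fun a => by simpa [maxPartialSum] using IncrOf.const Y 0
  | succ n ih =>
    intro a
    have e : ∀ ω, ∑ i ∈ Finset.range (n + 1), Y (a + i) ω - maxPartialSum Y (n + 1) a ω =
        min (∑ i ∈ Finset.range (n + 1), Y (a + i) ω)
          (∑ i ∈ Finset.range n, Y (a + 1 + i) ω - maxPartialSum Y n (a + 1) ω) := by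
      intro ω
      simp only [maxPartialSum]
      rw [sum_range_succ_shift]
      rcases le_total 0 (Y a ω + maxPartialSum Y n (a + 1) ω) with h | h
      · rw [max_eq_right h, min_eq_right] <;> linarith
      · rw [max_eq_left h, min_eq_left] <;> linarith
    simp_rw [e]
    exact (IncrOf.sum _ _ fun i _ => IncrOf.coord Y _).min (ih (a + 1))

theorem abs_maxPartialSum_le (hb : ∀ i ω, |Y i ω| ≤ 1) (n : ℕ) : ∀ a ω,
    |maxPartialSum Y n a ω| ≤ n := by
  induction n with
  | zero => simp [maxPartialSum]
  | succ n ih =>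
    intro a ω
    have h1 := abs_le.1 (hb a ω)
    have h2 := abs_le.1 (ih (a + 1) ω)
    rw [abs_of_nonneg (maxPartialSum_nonneg _ _ _)]
    simp only [maxPartialSum]
    push_cast
    exact max_le (by positivity) (by linarith)

theorem abs_sum_range_le (hb : ∀ i ω, |Y i ω| ≤ 1) (n a : ℕ) (ω : Ω) :
    |∑ i ∈ Finset.range n, Y (a + i) ω| ≤ n := by
  refine (Finset.abs_sum_le_sum_abs _ _).trans ((Finset.sum_le_sum fun i _ => hb (a + i) ω).trans ?_)
  simp

variable [MeasurableSpace Ω] {P : Measure Ω} [IsProbabilityMeasure P]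

theorem measurable_maxPartialSum (hm : ∀ i, Measurable (Y i)) (n : ℕ) : ∀ a,
    Measurable (maxPartialSum Y n a) := by
  induction n with
  | zero => exact fun a => measurable_const
  | succ n ih => exact fun a => measurable_const.max ((hm a).add (ih (a + 1)))

theorem measurable_sum_range (hm : ∀ i, Measurable (Y i)) (n a : ℕ) :
    Measurable (fun ω => ∑ i ∈ Finset.range n, Y (a + i) ω) :=
  Finset.measurable_sum _ fun _ _ => hm _

theorem integral_add_sq {U V : Ω → ℝ} (mU : Measurable U) (mV : Measurable V) {R R' : ℝ}
    (bU : ∀ ω, |U ω| ≤ R) (bV : ∀ ω, |V ω| ≤ R') :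
    ∫ ω, (U ω + V ω) ^ 2 ∂P =
      ∫ ω, U ω ^ 2 ∂P + 2 * ∫ ω, U ω * V ω ∂P + ∫ ω, V ω ^ 2 ∂P := by
  have i1 : Integrable (fun ω => U ω ^ 2) P :=
    integrable_of_abs_le (mU.pow_const 2) (R := R ^ 2) fun ω => by
      rw [abs_pow]; exact pow_le_pow_left₀ (abs_nonneg _) (bU ω) 2
  have i2 : Integrable (fun ω => V ω ^ 2) P :=
    integrable_of_abs_le (mV.pow_const 2) (R := R' ^ 2) fun ω => by
      rw [abs_pow]; exact pow_le_pow_left₀ (abs_nonneg _) (bV ω) 2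
  have i3 : Integrable (fun ω => 2 * (U ω * V ω)) P :=
    (integrable_of_abs_le (mU.mul mV) (R := R * R') fun ω => by
      rw [Pi.mul_apply, abs_mul]
      exact mul_le_mul (bU ω) (bV ω) (abs_nonneg _) ((abs_nonneg _).trans (bU ω))).const_mul 2
  have e : ∀ ω, (U ω + V ω) ^ 2 = U ω ^ 2 + 2 * (U ω * V ω) + V ω ^ 2 := fun ω => by ring
  have i4 : Integrable (fun ω => U ω ^ 2 + 2 * (U ω * V ω)) P := i1.add i3
  simp_rw [e]
  rw [integral_add i4 i2, integral_add i1 i3, integral_const_mul]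

/-- The second moment form of the Newman–Wright maximal inequality. -/
theorem integral_maxPartialSum_sq_le (hY : AssociatedSeq Y P) (hm : ∀ i, Measurable (Y i))
    (hb : ∀ i ω, |Y i ω| ≤ 1) (h0 : ∀ i, ∫ ω, Y i ω ∂P = 0) (n : ℕ) : ∀ a,
    ∫ ω, maxPartialSum Y n a ω ^ 2 ∂P ≤ ∫ ω, (∑ i ∈ Finset.range n, Y (a + i) ω) ^ 2 ∂P := by
  induction n with
  | zero => simp [maxPartialSum]
  | succ n ih =>
    intro a
    have mM := measurable_maxPartialSum hm n (a + 1)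
    have bM := abs_maxPartialSum_le hb n (a + 1)
    have mS := measurable_sum_range hm n (a + 1)
    have bS := abs_sum_range_le hb n (a + 1)
    -- `Y a` and the last sum minus the maximum are both increasing and `Y a` is centred, so the
    -- expectation of their product is nonnegative.
    have key : ∫ ω, Y a ω * maxPartialSum Y n (a + 1) ω ∂P ≤
        ∫ ω, Y a ω * ∑ i ∈ Finset.range n, Y (a + 1 + i) ω ∂P := by
      have h := hY.integral_mul_integral_le_of_bdd (IncrOf.coord Y a)
        (incrOf_sum_sub_maxPartialSum n (a + 1)) (hm a) (mS.sub mM) (hb a)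
        (fun ω => (abs_sub _ _).trans (add_le_add (bS ω) (bM ω)))
      rw [h0, zero_mul] at h
      simp_rw [mul_sub] at h
      rw [integral_sub] at h
      · linarith
      · exact integrable_of_abs_le (R := 1 * n) ((hm a).mul mS) fun ω => by
          rw [abs_mul]
          exact mul_le_mul (hb a ω) (bS ω) (abs_nonneg _) zero_le_one
      · exact integrable_of_abs_le (R := 1 * n) ((hm a).mul mM) fun ω => by
          rw [abs_mul]
          exact mul_le_mul (hb a ω) (bM ω) (abs_nonneg _) zero_le_one
    calc ∫ ω, maxPartialSum Y (n + 1) a ω ^ 2 ∂P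
        ≤ ∫ ω, (Y a ω + maxPartialSum Y n (a + 1) ω) ^ 2 ∂P := by
          refine integral_mono_of_nonneg (ae_of_all _ fun ω => sq_nonneg _) ?_
            (ae_of_all _ fun ω => ?_)
          · refine integrable_of_abs_le (R := (1 + n) ^ 2) (((hm a).add mM).pow_const 2) fun ω => ?_
            rw [abs_pow]
            exact pow_le_pow_left₀ (abs_nonneg _)
              ((abs_add_le _ _).trans (add_le_add (hb a ω) (bM ω))) 2
          · simp only [maxPartialSum]
            rcases le_total 0 (Y a ω + maxPartialSum Y n (a + 1) ω) with h | h
            · rw [max_eq_right h]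
            · rw [max_eq_left h, zero_pow two_ne_zero]; exact sq_nonneg _
      _ = ∫ ω, Y a ω ^ 2 ∂P + 2 * ∫ ω, Y a ω * maxPartialSum Y n (a + 1) ω ∂P
          + ∫ ω, maxPartialSum Y n (a + 1) ω ^ 2 ∂P := integral_add_sq (hm a) mM (hb a) bM
      _ ≤ ∫ ω, Y a ω ^ 2 ∂P + 2 * ∫ ω, Y a ω * ∑ i ∈ Finset.range n, Y (a + 1 + i) ω ∂P
          + ∫ ω, (∑ i ∈ Finset.range n, Y (a + 1 + i) ω) ^ 2 ∂P := by
          have := ih (a + 1); gcongr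
      _ = ∫ ω, (∑ i ∈ Finset.range (n + 1), Y (a + i) ω) ^ 2 ∂P := by
          rw [← integral_add_sq (hm a) mS (hb a) bS]
          simp_rw [sum_range_succ_shift]

theorem measureReal_eq_integral_indicator {Ω : Type*} [MeasurableSpace Ω] {P : Measure Ω}
    {s : Set Ω} (hs : MeasurableSet s) :
    P.real s = ∫ ω, s.indicator (fun _ => (1 : ℝ)) ω ∂P := by
  rw [integral_indicator_const _ hs, smul_eq_mul, mul_one]

/-- Upper level sets of increasing functions are positively correlated. -/
theorem AssociatedSeq.measureReal_mul_le (hX : AssociatedSeq Y P) {U V : Ω → ℝ}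
    (hU : IncrOf Y U) (hV : IncrOf Y V) (mU : Measurable U) (mV : Measurable V) {A B : Set ℝ}
    (hA : IsUpperSet A) (hB : IsUpperSet B) (mA : MeasurableSet A) (mB : MeasurableSet B) :
    P.real (U ⁻¹' A) * P.real (V ⁻¹' B) ≤ P.real (U ⁻¹' A ∩ V ⁻¹' B) := by
  have mono : ∀ {D : Set ℝ}, IsUpperSet D → Monotone (D.indicator (fun _ => (1 : ℝ))) := by
    intro D hD x y hxy
    by_cases hx : x ∈ D
    · simp [hx, hD hxy hx]
    · simpa [hx] using Set.indicator_nonneg (fun _ _ => zero_le_one) y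
  have bd : ∀ (D : Set ℝ) (x : ℝ), |D.indicator (fun _ => (1 : ℝ)) x| ≤ 1 := by
    intro D x
    by_cases hx : x ∈ D <;> simp [hx]
  have h := hX.integral_mul_integral_le_of_bdd (hU.comp (mono hA)) (hV.comp (mono hB))
    ((measurable_const.indicator mA).comp mU) ((measurable_const.indicator mB).comp mV)
    (fun ω => bd A _) (fun ω => bd B _)
  rw [measureReal_eq_integral_indicator (mU mA), measureReal_eq_integral_indicator (mV mB),
    measureReal_eq_integral_indicator ((mU mA).inter (mV mB))]
  refine h.trans (le_of_eq (integral_congr_ae (ae_of_all _ fun ω => ?_)))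
  by_cases h1 : U ω ∈ A <;> by_cases h2 : V ω ∈ B <;> simp [Set.indicator, h1, h2]

/-- The Newman–Wright maximal inequality: the maximum of the partial sums is controlled
by the last one. -/
theorem measureReal_maxPartialSum_ge_le (hY : AssociatedSeq Y P) (hm : ∀ i, Measurable (Y i))
    (hb : ∀ i ω, |Y i ω| ≤ 1) (h0 : ∀ i, ∫ ω, Y i ω ∂P = 0) (n a : ℕ) {T W : ℝ} (hT : 0 < T)
    (hW : ∫ ω, (∑ i ∈ Finset.range n, Y (a + i) ω) ^ 2 ∂P ≤ W) (hTW : 32 * W ≤ T ^ 2) :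
    P.real {ω | T ≤ maxPartialSum Y n a ω} ≤
      2 * P.real {ω | T / 2 ≤ ∑ i ∈ Finset.range n, Y (a + i) ω} := by
  set M := maxPartialSum Y n a
  set S : Ω → ℝ := fun ω => ∑ i ∈ Finset.range n, Y (a + i) ω
  have mM : Measurable M := measurable_maxPartialSum hm n a
  have bM : ∀ ω, |M ω| ≤ n := abs_maxPartialSum_le hb n a
  have mS : Measurable S := measurable_sum_range hm n a
  have bS : ∀ ω, |S ω| ≤ n := abs_sum_range_le hb n a
  set E : Set Ω := M ⁻¹' Set.Ici T
  set D : Set Ω := (fun ω => S ω - M ω) ⁻¹' Set.Ioi (-(T / 2))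
  have mD : MeasurableSet D := (mS.sub mM) measurableSet_Ioi
  -- On `E ∩ D` the last sum exceeds `T / 2`, so it remains to show that `D` has probability at
  -- least `1 / 2`.
  have hpos : P.real E * P.real D ≤ P.real (E ∩ D) :=
    hY.measureReal_mul_le (incrOf_maxPartialSum n a) (incrOf_sum_sub_maxPartialSum n a) mM
      (mS.sub mM) (isUpperSet_Ici T) (isUpperSet_Ioi _) measurableSet_Ici measurableSet_Ioi
  have hsplit : P.real E = P.real (E ∩ D) + P.real (E \ D) :=
    (measureReal_inter_add_sdiff mD).symm
  have hsub : E ∩ D ⊆ {ω | T / 2 ≤ S ω} := by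
    rintro ω ⟨h1, h2⟩
    simp only [E, D, Set.mem_preimage, Set.mem_Ici, Set.mem_Ioi, Set.mem_ofPred_eq] at *
    linarith
  have hle := measureReal_mono (μ := P) hsub
  have hDc : P.real Dᶜ ≤ 1 / 2 := by
    have hmark : T ^ 2 / 4 * P.real {ω | T ^ 2 / 4 ≤ (M ω + -S ω) ^ 2} ≤
        ∫ ω, (M ω + -S ω) ^ 2 ∂P :=
      mul_meas_ge_le_integral_of_nonneg (ae_of_all _ fun ω => sq_nonneg _)
        (integrable_of_abs_le (R := (n + n : ℝ) ^ 2) ((mM.add mS.neg).pow_const 2) fun ω => by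
          rw [abs_pow]
          refine pow_le_pow_left₀ (abs_nonneg _) ((abs_add_le _ _).trans ?_) 2
          rw [Pi.neg_apply, abs_neg]
          exact add_le_add (bM ω) (bS ω)) _
    have hincl : Dᶜ ⊆ {ω | T ^ 2 / 4 ≤ (M ω + -S ω) ^ 2} := by
      intro ω hω
      simp only [D, Set.mem_compl_iff, Set.mem_preimage, Set.mem_Ioi, not_lt,
        Set.mem_ofPred_eq] at *
      nlinarith
    have h1 := measureReal_mono (μ := P) hincl
    -- Parallelogram identity, with the square of `M + S` dropped and the second moment of `M`
    -- bounded by that of `S`. Since `32 * W ≤ T ^ 2`, Markov's inequality at `T ^ 2 / 4` then gives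
    -- `1 / 2`.
    have h2 : ∫ ω, (M ω + -S ω) ^ 2 ∂P ≤ 4 * W := by
      have hM2 : ∫ ω, M ω ^ 2 ∂P ≤ ∫ ω, S ω ^ 2 ∂P :=
        integral_maxPartialSum_sq_le hY hm hb h0 n a
      have e1 := integral_add_sq (P := P) mM mS bM bS
      have e2 := integral_add_sq (P := P) mM mS.neg bM (fun ω => (abs_neg (S ω)).trans_le (bS ω))
      have e3 : 0 ≤ ∫ ω, (M ω + S ω) ^ 2 ∂P := integral_nonneg fun ω => sq_nonneg _
      simp only [Pi.neg_apply, mul_neg, integral_neg, neg_sq] at e2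
      rw [e2]
      linarith
    have h3 : T ^ 2 / 4 * P.real Dᶜ ≤ T ^ 2 / 4 * (1 / 2) := by
      calc T ^ 2 / 4 * P.real Dᶜ ≤ T ^ 2 / 4 * P.real {ω | T ^ 2 / 4 ≤ (M ω + -S ω) ^ 2} := by
            gcongr
        _ ≤ T ^ 2 / 4 * (1 / 2) := by linarith
    exact le_of_mul_le_mul_left h3 (by positivity)
  rw [probReal_compl_eq_one_sub mD] at hDc
  have hE : 0 ≤ P.real E := measureReal_nonneg
  change P.real E ≤ 2 * P.real {ω | T / 2 ≤ S ω}
  nlinarith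

end MaximalInequality

/-! ### Comparison with independent blocks -/

section Comparison

/-- A layer-cake formula for a function of a sum of two bounded random variables. -/
theorem integral_comp_add_eq {Ω : Type*} [MeasurableSpace Ω] {P : Measure Ω}
    [IsProbabilityMeasure P] {U V : Ω → ℝ} (mU : Measurable U) (mV : Measurable V) {R : ℝ}
    (bU : ∀ ω, |U ω| ≤ R) (bV : ∀ ω, |V ω| ≤ R) {φ φ' : ℝ → ℝ}
    (hφ : ∀ x, HasDerivAt φ (φ' x) x) (cφ' : Continuous φ') :
    ∫ ω, φ (U ω + V ω) ∂P = ∫ ω, φ (U ω - R) ∂P +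
      ∫ y in Set.Ioc (-R) R, ∫ ω, (Set.Iic (V ω)).indicator (fun _ => (1 : ℝ)) y * φ' (U ω + y) ∂P := by
  have cφ : Continuous φ := continuous_iff_continuousAt.2 fun x => (hφ x).continuousAt
  obtain ⟨C, hC⟩ := (isCompact_Icc (a := -R - R) (b := R + R)).exists_bound_of_continuousOn
    cφ.continuousOn
  obtain ⟨C', hC'⟩ := (isCompact_Icc (a := -R - R) (b := R + R)).exists_bound_of_continuousOn
    cφ'.continuousOn
  -- Fundamental theorem of calculus from `-R` to `V ω`; the indicator carries the upper limit, so
  -- that Fubini can move the integral in `y` outside.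
  have hpt : ∀ ω, φ (U ω + V ω) = φ (U ω - R) + ∫ y in Set.Ioc (-R) R,
      (Set.Iic (V ω)).indicator (fun _ => (1 : ℝ)) y * φ' (U ω + y) := by
    intro ω
    have h1 := abs_le.1 (bV ω)
    have hd : ∀ y ∈ Set.uIcc (-R) (V ω), HasDerivAt (fun y => φ (U ω + y)) (φ' (U ω + y)) y := by
      intro y _
      simpa using (hφ (U ω + y)).comp_const_add (U ω) y
    have h2 := intervalIntegral.integral_eq_sub_of_hasDerivAt hd
      ((cφ'.comp (continuous_const.add continuous_id)).intervalIntegrable _ _)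
    have h3 : ∀ y, (Set.Iic (V ω)).indicator (fun _ => (1 : ℝ)) y * φ' (U ω + y) =
        (Set.Iic (V ω)).indicator (fun y => φ' (U ω + y)) y := fun y => by
      by_cases hy : y ∈ Set.Iic (V ω) <;> simp [hy]
    simp_rw [h3]
    rw [setIntegral_indicator measurableSet_Iic, Set.Ioc_inter_Iic, min_eq_right h1.2,
      ← intervalIntegral.integral_of_le h1.1, h2, ← sub_eq_add_neg]
    ring
  have mind : Measurable fun z : Ω × ℝ =>
      (Set.Iic (V z.1)).indicator (fun _ => (1 : ℝ)) z.2 * φ' (U z.1 + z.2) := by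
    refine Measurable.mul ?_ (cφ'.measurable.comp ((mU.comp measurable_fst).add measurable_snd))
    exact measurable_const.indicator (s := {z : Ω × ℝ | z.2 ≤ V z.1})
      (measurableSet_le measurable_snd (mV.comp measurable_fst))
  have iind : Integrable (Function.uncurry fun (ω : Ω) (y : ℝ) =>
      (Set.Iic (V ω)).indicator (fun _ => (1 : ℝ)) y * φ' (U ω + y))
      (P.prod (volume.restrict (Set.Ioc (-R) R))) := by
    refine Integrable.of_bound mind.aestronglyMeasurable (max C' 0) ?_
    have hmem : ∀ᵐ z : Ω × ℝ ∂(P.prod (volume.restrict (Set.Ioc (-R) R))),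
        z.2 ∈ Set.Ioc (-R) R :=
      Measure.quasiMeasurePreserving_snd.ae (ae_restrict_mem measurableSet_Ioc)
    filter_upwards [hmem] with z hz
    have h1 := abs_le.1 (bU z.1)
    simp only [Function.uncurry, norm_mul]
    by_cases hy : z.2 ∈ Set.Iic (V z.1)
    · simp only [Set.indicator_of_mem hy, norm_one, one_mul]
      exact (hC' _ ⟨by linarith [hz.1], by linarith [hz.2]⟩).trans (le_max_left _ _)
    · simp [Set.indicator_of_notMem hy]
  simp_rw [hpt]
  rw [integral_add, integral_integral_swap iind]
  · refine integrable_of_abs_le (R := C) (cφ.measurable.comp (mU.sub_const R)) fun ω => ?_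
    have h1 := abs_le.1 (bU ω)
    exact hC _ ⟨by linarith, by linarith⟩
  · exact iind.integral_prod_left

variable {Ω : Type*} [MeasurableSpace Ω] {P : Measure Ω} [IsProbabilityMeasure P]
  {X : ℕ → Ω → ℝ} {A B : Ω → ℝ}

/-- For associated `A` and `B`, `φ (A + B)` with `φ` convex has at least the expectation it would
have if `A` and `B` were independent. -/
theorem AssociatedSeq.integral_prod_comp_add_le (hX : AssociatedSeq X P) (hA : IncrOf X A)
    (hB : IncrOf X B) (mA : Measurable A) (mB : Measurable B) {R : ℝ} (bA : ∀ ω, |A ω| ≤ R)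
    (bB : ∀ ω, |B ω| ≤ R) {φ φ' : ℝ → ℝ} (hφ : ∀ x, HasDerivAt φ (φ' x) x)
    (cφ' : Continuous φ') (mono : Monotone φ') :
    ∫ z : Ω × Ω, φ (A z.1 + B z.2) ∂(P.prod P) ≤ ∫ ω, φ (A ω + B ω) ∂P := by
  obtain ⟨C', hC'⟩ := (isCompact_Icc (a := -R - R) (b := R + R)).exists_bound_of_continuousOn
    cφ'.continuousOn
  have bφ' : ∀ y ∈ Set.Ioc (-R) R, ∀ ω, |φ' (A ω + y)| ≤ C' := fun y hy ω => by
    have h1 := abs_le.1 (bA ω)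
    exact hC' _ ⟨by linarith [hy.1], by linarith [hy.2]⟩
  have mI : ∀ y, Measurable fun ω => (Set.Iic (B ω)).indicator (fun _ => (1 : ℝ)) y := fun y =>
    measurable_const.indicator (s := {ω | y ≤ B ω}) (measurableSet_le measurable_const mB)
  have bI : ∀ y ω, |(Set.Iic (B ω)).indicator (fun _ => (1 : ℝ)) y| ≤ 1 := fun y ω => by
    by_cases hy : y ∈ Set.Iic (B ω) <;> simp [hy]
  have mφ : ∀ y, Measurable fun ω => φ' (A ω + y) := fun y =>
    cφ'.measurable.comp (mA.add_const y)
  have hprod : ∀ y, ∫ z : Ω × Ω, (Set.Iic (B z.2)).indicator (fun _ => (1 : ℝ)) y *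
      φ' (A z.1 + y) ∂(P.prod P) =
      (∫ ω, (Set.Iic (B ω)).indicator (fun _ => (1 : ℝ)) y ∂P) * ∫ ω, φ' (A ω + y) ∂P := by
    intro y
    have := integral_prod_mul (μ := P) (ν := P) (fun ω => φ' (A ω + y))
      (fun ω => (Set.Iic (B ω)).indicator (fun _ => (1 : ℝ)) y)
    simp_rw [mul_comm _ (φ' _)]
    rw [this, mul_comm]
  rw [integral_comp_add_eq (P := P) mA mB bA bB hφ cφ',
    integral_comp_add_eq (P := P.prod P) (U := fun z => A z.1) (V := fun z => B z.2)
      (mA.comp measurable_fst) (mB.comp measurable_snd) (fun z => bA z.1) (fun z => bB z.2) hφ cφ']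
  have hfst : ∫ z : Ω × Ω, φ (A z.1 - R) ∂(P.prod P) = ∫ ω, φ (A ω - R) ∂P := by
    have := integral_prod_mul (μ := P) (ν := P) (fun ω => φ (A ω - R)) (fun _ => (1 : ℝ))
    simpa using this
  rw [hfst]
  refine add_le_add_right ?_ _
  simp_rw [hprod]
  have hmono : ∀ y, Monotone fun b : ℝ => (Set.Iic b).indicator (fun _ => (1 : ℝ)) y := by
    intro y b b' h
    exact Set.indicator_le_indicator_of_subset (Set.Iic_subset_Iic.2 h) (fun _ => zero_le_one) y
  -- For fixed `y`, the indicator of `y ≤ B` and `φ' (A + y)` are increasing in `B` and `A`, so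
  -- association decouples them in the required direction.
  have hle : ∀ y ∈ Set.Ioc (-R) R,
      (∫ ω, (Set.Iic (B ω)).indicator (fun _ => (1 : ℝ)) y ∂P) * ∫ ω, φ' (A ω + y) ∂P ≤
        ∫ ω, (Set.Iic (B ω)).indicator (fun _ => (1 : ℝ)) y * φ' (A ω + y) ∂P := fun y hy =>
    hX.integral_mul_integral_le_of_bdd (hB.comp (hmono y))
      (hA.comp (φ := fun a => φ' (a + y)) fun a a' h => mono (add_le_add_left h y)) (mI y) (mφ y) (bI y) (bφ' y hy)
  have mjoint : Measurable fun z : ℝ × Ω => (Set.Iic (B z.2)).indicator (fun _ => (1 : ℝ)) z.1 :=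
    measurable_const.indicator (s := {z : ℝ × Ω | z.1 ≤ B z.2})
      (measurableSet_le measurable_fst (mB.comp measurable_snd))
  have mjoint' : Measurable fun z : ℝ × Ω => φ' (A z.2 + z.1) :=
    cφ'.measurable.comp ((mA.comp measurable_snd).add measurable_fst)
  have bound : ∀ {f : Ω → ℝ} {c : ℝ}, (∀ ω, |f ω| ≤ c) → |∫ ω, f ω ∂P| ≤ c := by
    intro f c h
    simpa using norm_integral_le_of_norm_le_const (μ := P) (f := f) (C := c) (ae_of_all _ h)
  refine setIntegral_mono_on ?_ ?_ measurableSet_Ioc hle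
  · refine Integrable.of_bound (C := 1 * C')
      ((mjoint.stronglyMeasurable.integral_prod_right'.mul
        mjoint'.stronglyMeasurable.integral_prod_right').aestronglyMeasurable) ?_
    filter_upwards [ae_restrict_mem measurableSet_Ioc] with y hy
    rw [norm_mul]
    exact mul_le_mul (bound (bI y)) (bound (bφ' y hy)) (norm_nonneg _) zero_le_one
  · refine Integrable.of_bound (C := 1 * C')
      ((mjoint.mul mjoint').stronglyMeasurable.integral_prod_right'.aestronglyMeasurable) ?_
    filter_upwards [ae_restrict_mem measurableSet_Ioc] with y hy
    refine bound fun ω => ?_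
    rw [abs_mul]
    exact mul_le_mul (bI y ω) (bφ' y hy ω) (abs_nonneg _) zero_le_one

/-- Comparison of `g (A + B)` with its version for independent `A` and `B`, for `g` whose
derivative is one-sided Lipschitz with constant `K`. -/
theorem AssociatedSeq.integral_comp_add_le (hX : AssociatedSeq X P) (hA : IncrOf X A)
    (hB : IncrOf X B) (mA : Measurable A) (mB : Measurable B) {R : ℝ} (bA : ∀ ω, |A ω| ≤ R)
    (bB : ∀ ω, |B ω| ≤ R) {g g' : ℝ → ℝ} (hg : ∀ x, HasDerivAt g (g' x) x)
    (cg' : Continuous g') {K : ℝ} (mono : Monotone fun x => K * x - g' x) :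
    ∫ ω, g (A ω + B ω) ∂P ≤ ∫ ω', ∫ ω, g (A ω + B ω') ∂P ∂P +
      K * (∫ ω, A ω * B ω ∂P - (∫ ω, A ω ∂P) * ∫ ω, B ω ∂P) := by
  have cg : Continuous g := continuous_iff_continuousAt.2 fun x => (hg x).continuousAt
  obtain ⟨C, hC⟩ := (isCompact_Icc (a := -R - R) (b := R + R)).exists_bound_of_continuousOn
    cg.continuousOn
  -- This function is convex by `mono`. Its quadratic part changes under decoupling by exactly `K`
  -- times the covariance of `A` and `B`.
  have h := hX.integral_prod_comp_add_le hA hB mA mB bA bB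
    (φ := fun x => K / 2 * x ^ 2 - g x) (φ' := fun x => K * x - g' x)
    (fun x => by
      have h1 := ((hasDerivAt_pow 2 x).const_mul (K / 2)).sub (hg x)
      exact h1.congr_deriv (by push_cast; ring)) ((continuous_const.mul continuous_id).sub cg') mono
  have bA' : ∀ z : Ω × Ω, |A z.1| ≤ R := fun z => bA _
  have bB' : ∀ z : Ω × Ω, |B z.2| ≤ R := fun z => bB _
  have mA' : Measurable fun z : Ω × Ω => A z.1 := mA.comp measurable_fst
  have mB' : Measurable fun z : Ω × Ω => B z.2 := mB.comp measurable_snd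
  have isq : ∀ {Ω' : Type _} [MeasurableSpace Ω'] {Q : Measure Ω'} [IsProbabilityMeasure Q]
      {U V : Ω' → ℝ}, Measurable U → Measurable V → (∀ ω, |U ω| ≤ R) → (∀ ω, |V ω| ≤ R) →
      Integrable (fun ω => K / 2 * (U ω + V ω) ^ 2) Q ∧ Integrable (fun ω => g (U ω + V ω)) Q := by
    intro Ω' _ Q _ U V mU mV bU bV
    constructor
    · refine (integrable_of_abs_le (R := (R + R) ^ 2) ((mU.add mV).pow_const 2) fun ω => ?_).const_mul _
      rw [abs_pow]
      exact pow_le_pow_left₀ (abs_nonneg _) ((abs_add_le _ _).trans (add_le_add (bU ω) (bV ω))) 2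
    · refine integrable_of_abs_le (R := C) (cg.measurable.comp (mU.add mV)) fun ω => ?_
      have h1 := abs_le.1 (bU ω)
      have h2 := abs_le.1 (bV ω)
      exact hC _ ⟨by linarith, by linarith⟩
  obtain ⟨i1, i2⟩ := isq (Q := P.prod P) mA' mB' bA' bB'
  obtain ⟨i3, i4⟩ := isq (Q := P) mA mB bA bB
  rw [integral_sub i1 i2, integral_sub i3 i4, integral_const_mul, integral_const_mul,
    integral_add_sq mA mB bA bB, integral_add_sq mA' mB' bA' bB'] at h
  have e1 : ∫ z : Ω × Ω, A z.1 ^ 2 ∂(P.prod P) = ∫ ω, A ω ^ 2 ∂P := by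
    simpa using integral_prod_mul (μ := P) (ν := P) (fun ω => A ω ^ 2) (fun _ => (1 : ℝ))
  have e2 : ∫ z : Ω × Ω, B z.2 ^ 2 ∂(P.prod P) = ∫ ω, B ω ^ 2 ∂P := by
    simpa using integral_prod_mul (μ := P) (ν := P) (fun _ => (1 : ℝ)) (fun ω => B ω ^ 2)
  rw [e1, e2, integral_prod_mul (μ := P) (ν := P) A B, integral_prod_symm _ i2] at h
  linarith

/-- A sum of associated blocks is compared, through a smooth function dominated by an exponential,
with the sum of independent copies of the blocks. -/
theorem AssociatedSeq.integral_comp_sum_le (hX : AssociatedSeq X P) {B : ℕ → Ω → ℝ}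
    (hB : ∀ k, IncrOf X (B k)) (mB : ∀ k, Measurable (B k)) {R : ℝ} (bB : ∀ k ω, |B k ω| ≤ R)
    (h0 : ∀ k, ∫ ω, B k ω ∂P = 0) {K l : ℝ} (m : ℕ) : ∀ {g g' : ℝ → ℝ} {c : ℝ},
    (∀ x, HasDerivAt g (g' x) x) → Continuous g' → (Monotone fun x => K * x - g' x) →
    (∀ x, g x ≤ c * Real.exp (l * x)) →
    ∫ ω, g (∑ k ∈ Finset.range m, B k ω) ∂P ≤
      c * ∏ k ∈ Finset.range m, ∫ ω, Real.exp (l * B k ω) ∂P +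
      K * ∑ k ∈ Finset.range m, ∫ ω, (∑ i ∈ Finset.range k, B i ω) * B k ω ∂P := by
  induction m with
  | zero =>
    intro g g' c _ _ _ hgc
    simpa using hgc 0
  | succ m ih =>
    intro g g' c hg cg' mono hgc
    have hR : ∀ ω : Ω, 0 ≤ R := fun ω => (abs_nonneg _).trans (bB 0 ω)
    have mA : Measurable fun ω => ∑ k ∈ Finset.range m, B k ω :=
      Finset.measurable_sum _ fun k _ => mB k
    have bA : ∀ ω, |∑ k ∈ Finset.range m, B k ω| ≤ m * R := fun ω =>
      (Finset.abs_sum_le_sum_abs _ _).trans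
        ((Finset.sum_le_sum fun k _ => bB k ω).trans (by simp))
    have key := hX.integral_comp_add_le (IncrOf.sum _ _ fun k _ => hB k) (hB m) mA (mB m)
      (R := m * R + R) (fun ω => (bA ω).trans (by linarith [hR ω]))
      (fun ω => (bB m ω).trans (by have := mul_nonneg (Nat.cast_nonneg (α := ℝ) m) (hR ω); linarith))
      hg cg' mono
    rw [h0 m, mul_zero, sub_zero] at key
    have cg : Continuous g := continuous_iff_continuousAt.2 fun x => (hg x).continuousAt
    obtain ⟨C, hC⟩ := (isCompact_Icc (a := -(m * R + R)) (b := m * R + R)).exists_bound_of_continuousOn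
      cg.continuousOn
    have mj : Measurable fun z : Ω × Ω => g (∑ k ∈ Finset.range m, B k z.2 + B m z.1) :=
      cg.measurable.comp ((mA.comp measurable_snd).add ((mB m).comp measurable_fst))
    have iexp : Integrable (fun ω => Real.exp (l * B m ω)) P := by
      refine integrable_of_abs_le (R := Real.exp (|l| * R))
        (Real.measurable_exp.comp ((mB m).const_mul l)) fun ω => ?_
      rw [abs_of_pos (Real.exp_pos _)]
      refine Real.exp_le_exp.2 ((le_abs_self _).trans ?_)
      rw [abs_mul]
      exact mul_le_mul_of_nonneg_left (bB m ω) (abs_nonneg l)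
    set E : ℝ := ∏ k ∈ Finset.range m, ∫ ω, Real.exp (l * B k ω) ∂P
    set D : ℝ := ∑ k ∈ Finset.range m, ∫ ω, (∑ i ∈ Finset.range k, B i ω) * B k ω ∂P
    -- With the last block frozen, the translate of `g` has the same `K`, and its exponential bound
    -- gains the factor `exp (l * B m ω')`. This is why `g` and `c` vary in the induction.
    have step : ∀ ω', ∫ ω, g (∑ k ∈ Finset.range m, B k ω + B m ω') ∂P ≤
        (c * E) * Real.exp (l * B m ω') + K * D := by
      intro ω'
      have := ih (g := fun x => g (x + B m ω')) (g' := fun x => g' (x + B m ω'))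
        (c := c * Real.exp (l * B m ω'))
        (fun x => (hg (x + B m ω')).comp_add_const x _)
        (cg'.comp (continuous_id.add continuous_const))
        (fun x y hxy => by
          have := mono (add_le_add_left hxy (B m ω'))
          simp only at this ⊢
          linarith)
        (fun x => (hgc _).trans_eq (by rw [mul_add, Real.exp_add]; ring))
      linarith
    have hint := integral_mono (μ := P) (f := fun ω' =>
      ∫ ω, g (∑ k ∈ Finset.range m, B k ω + B m ω') ∂P)
      (integrable_of_abs_le (R := C) mj.stronglyMeasurable.integral_prod_right'.measurable
        fun ω' => by
          have : ∀ ω, ‖g (∑ k ∈ Finset.range m, B k ω + B m ω')‖ ≤ C := fun ω => by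
            have h1 := abs_le.1 (bA ω)
            have h2 := abs_le.1 (bB m ω')
            exact hC _ ⟨by linarith, by linarith⟩
          simpa using norm_integral_le_of_norm_le_const (μ := P) (ae_of_all _ this))
      ((iexp.const_mul _).add (integrable_const _)) step
    simp only [Pi.add_apply] at hint
    rw [integral_add (iexp.const_mul _) (integrable_const _), integral_const_mul] at hint
    simp only [Finset.sum_range_succ, Finset.prod_range_succ]
    simp only [integral_const, probReal_univ, smul_eq_mul, one_mul] at hint
    linarith

end Comparison

/-! ### Moments and tails under polynomial covariance decay -/

/-- A centred associated sequence bounded by one, whose covariances decay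
with the exponent `1 + 2 s`. -/
structure IsWeaklyCorrelated {Ω : Type*} [MeasurableSpace Ω] (Y : ℕ → Ω → ℝ) (P : Measure Ω)
    (C s : ℝ) : Prop where
  assoc : AssociatedSeq Y P
  meas : ∀ i, Measurable (Y i)
  bdd : ∀ i ω, |Y i ω| ≤ 1
  mean : ∀ i, ∫ ω, Y i ω ∂P = 0
  cov : ∀ i k, ∫ ω, Y i ω * Y (i + k + 1) ω ∂P ≤ C * ((k : ℝ) + 1) ^ (-(1 + 2 * s))

/-- The sum of the series `∑ k, k ^ (-(1 + s))` over the positive integers. -/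
noncomputable def zetaSum (s : ℝ) : ℝ := ∑' k : ℕ, ((k : ℝ) + 1) ^ (-(1 + s))

theorem summable_zetaSum {s : ℝ} (hs : 0 < s) :
    Summable fun k : ℕ => ((k : ℝ) + 1) ^ (-(1 + s)) := by
  have h := (summable_nat_add_iff 1).2 (Real.summable_nat_rpow.2 (by linarith : -(1 + s) < -1))
  simpa using h

theorem zetaSum_nonneg (s : ℝ) : 0 ≤ zetaSum s :=
  tsum_nonneg fun k => by positivity

section Moments

variable {Ω : Type*} [MeasurableSpace Ω] {P : Measure Ω} [IsProbabilityMeasure P]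
  {Y : ℕ → Ω → ℝ} {C s : ℝ}

theorem IsWeaklyCorrelated.shift (h : IsWeaklyCorrelated Y P C s) (a : ℕ) :
    IsWeaklyCorrelated (fun i => Y (a + i)) P C s where
  assoc := h.assoc.of_incrOf fun i => IncrOf.coord Y (a + i)
  meas _ := h.meas _
  bdd _ := h.bdd _
  mean _ := h.mean _
  cov i k := by simpa only [add_assoc] using h.cov (a + i) k

theorem IsWeaklyCorrelated.integrable_mul (h : IsWeaklyCorrelated Y P C s) (i j : ℕ) :
    Integrable (fun ω => Y i ω * Y j ω) P :=
  integrable_of_abs_le (R := 1 * 1) ((h.meas i).mul (h.meas j)) fun ω => by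
    rw [abs_mul]
    exact mul_le_mul (h.bdd i ω) (h.bdd j ω) (abs_nonneg _) zero_le_one

/-- The lag `j + k + 1` is at least `j + 1` and at least `k + 1`. Splitting the exponent as `1 + 2 s
= s + (1 + s)` gives a factor decaying in the gap `j` and a factor summable in `k`, where `k` counts
backwards from `n - 1`. -/
theorem IsWeaklyCorrelated.integral_sum_mul_le (h : IsWeaklyCorrelated Y P C s) (hs : 0 < s)
    (hC : 0 ≤ C) (n j : ℕ) :
    ∫ ω, (∑ i ∈ Finset.range n, Y i ω) * Y (n + j) ω ∂P ≤
      C * zetaSum s * ((j : ℝ) + 1) ^ (-s) := by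
  simp_rw [Finset.sum_mul]
  rw [integral_finsetSum _ fun i _ => h.integrable_mul i (n + j), ← Finset.sum_range_reflect]
  calc ∑ k ∈ Finset.range n, ∫ ω, Y (n - 1 - k) ω * Y (n + j) ω ∂P
      ≤ ∑ k ∈ Finset.range n, C * ((j : ℝ) + 1) ^ (-s) * ((k : ℝ) + 1) ^ (-(1 + s)) := by
        refine Finset.sum_le_sum fun k hk => ?_
        have hk' := Finset.mem_range.1 hk
        have e : n + j = n - 1 - k + (j + k) + 1 := by omega
        have hc := h.cov (n - 1 - k) (j + k)
        rw [← e] at hc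
        refine hc.trans ?_
        rw [mul_assoc]
        refine mul_le_mul_of_nonneg_left ?_ hC
        push_cast
        have hj : (0 : ℝ) ≤ j := Nat.cast_nonneg j
        have hk0 : (0 : ℝ) ≤ k := Nat.cast_nonneg k
        rw [show -(1 + 2 * s) = -s + -(1 + s) by ring, Real.rpow_add (by positivity)]
        refine mul_le_mul ?_ ?_ (by positivity) (by positivity)
        · exact Real.rpow_le_rpow_of_nonpos (by positivity) (by linarith) (by linarith)
        · exact Real.rpow_le_rpow_of_nonpos (by positivity) (by linarith) (by linarith)
    _ ≤ C * zetaSum s * ((j : ℝ) + 1) ^ (-s) := by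
        rw [← Finset.mul_sum, mul_right_comm]
        refine mul_le_mul_of_nonneg_right (mul_le_mul_of_nonneg_left ?_ hC) (by positivity)
        exact (summable_zetaSum hs).sum_le_tsum _ fun k _ => by positivity

/-- Each new term adds its own variance, at most `1`, and twice its covariance with the past,
bounded by the previous lemma with gap `0`. -/
theorem IsWeaklyCorrelated.integral_sum_sq_le (h : IsWeaklyCorrelated Y P C s) (hs : 0 < s)
    (hC : 0 ≤ C) (n : ℕ) :
    ∫ ω, (∑ i ∈ Finset.range n, Y i ω) ^ 2 ∂P ≤ (1 + 2 * (C * zetaSum s)) * n := by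
  induction n with
  | zero => simp
  | succ n ih =>
    simp_rw [Finset.sum_range_succ]
    rw [integral_add_sq (R := n) (Finset.measurable_sum _ fun i _ => h.meas i) (h.meas n)
      (fun ω => by simpa using abs_sum_range_le h.bdd n 0 ω) (h.bdd n)]
    have h1 := h.integral_sum_mul_le hs hC n 0
    simp only [add_zero, Nat.cast_zero, zero_add, Real.one_rpow, mul_one] at h1
    have h2 : ∫ ω, Y n ω ^ 2 ∂P ≤ 1 := by
      have := integral_mono (μ := P) (f := fun ω => Y n ω ^ 2) (g := fun _ => (1 : ℝ))
        (integrable_of_abs_le (R := 1) ((h.meas n).pow_const 2) fun ω => by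
          rw [abs_pow]; exact pow_le_one₀ (abs_nonneg _) (h.bdd n ω))
        (integrable_const _) (fun ω => (sq_le_one_iff_abs_le_one _).2 (h.bdd n ω))
      simpa using this
    push_cast
    linarith

/-- Moment generating function of a bounded centred variable near zero. -/
theorem integral_exp_mul_le {U : Ω → ℝ} (mU : Measurable U) {R l V : ℝ} (bU : ∀ ω, |U ω| ≤ R)
    (h0 : ∫ ω, U ω ∂P = 0) (hl : 0 ≤ l) (hlR : l * R ≤ 1) (hV : ∫ ω, U ω ^ 2 ∂P ≤ V) :
    ∫ ω, Real.exp (l * U ω) ∂P ≤ Real.exp (l ^ 2 * V) := by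
  have hlU : ∀ ω, |l * U ω| ≤ 1 := fun ω => by
    rw [abs_mul, abs_of_nonneg hl]
    exact (mul_le_mul_of_nonneg_left (bU ω) hl).trans hlR
  have i1 : Integrable (fun ω => 1 + l * U ω) P :=
    (integrable_const _).add ((integrable_of_abs_le mU bU).const_mul l)
  have i2 : Integrable (fun ω => l ^ 2 * U ω ^ 2) P :=
    (integrable_of_abs_le (mU.pow_const 2) (R := R ^ 2) fun ω => by
      rw [abs_pow]; exact pow_le_pow_left₀ (abs_nonneg _) (bU ω) 2).const_mul _
  calc ∫ ω, Real.exp (l * U ω) ∂P ≤ ∫ ω, (1 + l * U ω) + l ^ 2 * U ω ^ 2 ∂P := by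
        refine integral_mono_of_nonneg (ae_of_all _ fun ω => (Real.exp_pos _).le) (i1.add i2)
          (ae_of_all _ fun ω => ?_)
        have := (abs_le.1 (Real.abs_exp_sub_one_sub_id_le (hlU ω))).2
        simp only
        nlinarith
    _ = 1 + l ^ 2 * ∫ ω, U ω ^ 2 ∂P := by
        rw [integral_add i1 i2, integral_add (integrable_const _)
          ((integrable_of_abs_le mU bU).const_mul l), integral_const_mul, integral_const_mul, h0]
        simp
    _ ≤ 1 + l ^ 2 * V := by gcongr
    _ ≤ Real.exp (l ^ 2 * V) := by linarith [Real.add_one_le_exp (l ^ 2 * V)]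

/-- The derivative is `C¹` and vanishes outside `[0, 1]`, hence is Lipschitz. Rescaled, this
provides the curvature constant of the test function in the comparison. -/
theorem exists_deriv_smoothTransition_sub_le :
    ∃ K : ℝ, 0 ≤ K ∧ ∀ x y, x ≤ y →
      deriv Real.smoothTransition y - deriv Real.smoothTransition x ≤ K * (y - x) := by
  have hcd : ContDiff ℝ 1 (deriv Real.smoothTransition) :=
    ((contDiff_succ_iff_deriv (n := 1)).1 (Real.smoothTransition.contDiff (n := 1 + 1))).2.2
  have hsupp : HasCompactSupport (deriv Real.smoothTransition) := by
    refine HasCompactSupport.of_support_subset_isCompact (isCompact_Icc (a := (0 : ℝ)) (b := 1)) ?_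
    intro x hx
    by_contra hx'
    apply hx
    rw [Set.mem_Icc, not_and_or, not_le, not_le] at hx'
    rcases hx' with h | h
    · have : Real.smoothTransition =ᶠ[nhds x] fun _ => 0 := by
        filter_upwards [Iio_mem_nhds h] with y hy
        exact Real.smoothTransition.zero_of_nonpos (le_of_lt hy)
      rw [this.deriv_eq, deriv_const]
    · have : Real.smoothTransition =ᶠ[nhds x] fun _ => 1 := by
        filter_upwards [Ioi_mem_nhds h] with y hy
        exact Real.smoothTransition.one_of_one_le (le_of_lt hy)
      rw [this.deriv_eq, deriv_const]
  obtain ⟨K, hK⟩ := hcd.lipschitzWith_of_hasCompactSupport hsupp one_ne_zero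
  refine ⟨K, K.2, fun x y hxy => ?_⟩
  have := hK.dist_le_mul y x
  rw [Real.dist_eq, Real.dist_eq, abs_of_nonneg (sub_nonneg.2 hxy)] at this
  exact (le_abs_self _).trans this

theorem sum_range_mul_eq (f : ℕ → ℝ) (L k : ℕ) :
    ∑ b ∈ Finset.range k, ∑ i ∈ Finset.range L, f (b * L + i) =
      ∑ i ∈ Finset.range (k * L), f i := by
  induction k with
  | zero => simp
  | succ k ih => rw [Finset.sum_range_succ, ih, Nat.succ_mul, Finset.sum_range_add]

/-- Tail bound for the sum of `m` blocks of length `L`. -/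
theorem IsWeaklyCorrelated.measureReal_sum_ge_le (h : IsWeaklyCorrelated Y P C s) (hs : 0 < s)
    (hC : 0 ≤ C) {K : ℝ} (hK : ∀ x y, x ≤ y →
      deriv Real.smoothTransition y - deriv Real.smoothTransition x ≤ K * (y - x)) (hK0 : 0 ≤ K)
    {m L : ℕ} (hm : 0 < m) (hL : 0 < L) (hLm : L ≤ m) {T : ℝ} (hT : 0 < T) :
    P.real {ω | T ≤ ∑ i ∈ Finset.range (m * L), Y i ω} ≤
      Real.exp (1 + 2 * (C * zetaSum s) - T / (2 * √(m * L))) +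
      4 * K / T ^ 2 * (m * (C * zetaSum s * ∑ j ∈ Finset.range L, ((j : ℝ) + 1) ^ (-s))) := by
  set V := 1 + 2 * (C * zetaSum s)
  set B : ℕ → Ω → ℝ := fun k ω => ∑ i ∈ Finset.range L, Y (k * L + i) ω
  have hm' : (0 : ℝ) < m := Nat.cast_pos.2 hm
  have hL' : (0 : ℝ) < L := Nat.cast_pos.2 hL
  have hN : (0 : ℝ) < m * L := mul_pos hm' hL'
  -- With this `l`, the total variance term `l ^ 2 * V * (m * L)` is just `V`. The hypothesis `L ≤
  -- m` ensures `l * L ≤ 1`, as the moment generating function bound of a block requires.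
  set l : ℝ := 1 / √(m * L)
  have hl : 0 < l := by positivity
  have hl2 : l ^ 2 * (m * L) = 1 := by
    simp only [l, div_pow, one_pow, Real.sq_sqrt hN.le]
    field_simp
  have hlL : l * L ≤ 1 := by
    have hh : l * L ≤ l * √(m * L) := by
      refine mul_le_mul_of_nonneg_left (Real.le_sqrt_of_sq_le ?_) hl.le
      have : (L : ℝ) ≤ m := Nat.cast_le.2 hLm
      nlinarith
    refine hh.trans (le_of_eq ?_)
    simp only [l]
    field_simp
  have mB : ∀ k, Measurable (B k) := fun k => Finset.measurable_sum _ fun i _ => h.meas _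
  have bB : ∀ k ω, |B k ω| ≤ L := fun k => abs_sum_range_le h.bdd L (k * L)
  have h0 : ∀ k, ∫ ω, B k ω ∂P = 0 := fun k => by
    rw [integral_finsetSum _ fun i _ => integrable_of_abs_le (h.meas _) (h.bdd _)]
    simp [h.mean]
  have hBsum : ∀ k ω, ∑ b ∈ Finset.range k, B b ω = ∑ i ∈ Finset.range (k * L), Y i ω :=
    fun k ω => sum_range_mul_eq (fun i => Y i ω) L k
  have hσ : ∀ x, HasDerivAt Real.smoothTransition (deriv Real.smoothTransition x) x := fun x =>
    ((Real.smoothTransition.contDiff (n := 1)).differentiable one_ne_zero x).hasDerivAt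
  have main := h.assoc.integral_comp_sum_le (B := B)
    (fun k => IncrOf.sum _ _ fun i _ => IncrOf.coord Y _) mB bB h0 (K := 4 * K / T ^ 2) (l := l) m
    -- This step vanishes below `T / 2` and equals `1` from `T` on. The scaling by `2 / T` turns `K`
    -- into `4 * K / T ^ 2`, and vanishing below `T / 2` gives the bound `exp (l * (x - T / 2))`,
    -- whence `c`.
    (g := fun x => Real.smoothTransition (2 / T * x - 1))
    (g' := fun x => deriv Real.smoothTransition (2 / T * x - 1) * (2 / T))
    (c := Real.exp (-(T / (2 * √(m * L)))))
    (fun x => (hσ _).comp x (by simpa using ((hasDerivAt_id x).const_mul (2 / T)).sub_const 1))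
    (((Real.smoothTransition.contDiff (n := 1)).continuous_deriv le_rfl |>.comp (by fun_prop)).mul
      continuous_const)
    (fun x y hxy => by
      have h1 := hK (2 / T * x - 1) (2 / T * y - 1) (by gcongr)
      have h2 : (deriv Real.smoothTransition (2 / T * y - 1) -
          deriv Real.smoothTransition (2 / T * x - 1)) * (2 / T) ≤
          K * (2 / T * y - 1 - (2 / T * x - 1)) * (2 / T) :=
        mul_le_mul_of_nonneg_right h1 (by positivity)
      have h3 : K * (2 / T * y - 1 - (2 / T * x - 1)) * (2 / T) =
          4 * K / T ^ 2 * y - 4 * K / T ^ 2 * x := by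
        field_simp
        ring
      simp only
      linarith)
    (fun x => by
      rw [← Real.exp_add]
      rcases le_total x (T / 2) with hx | hx
      · have : 2 / T * x - 1 ≤ 0 := by
          rw [sub_nonpos, div_mul_eq_mul_div, div_le_one hT]; linarith
        rw [Real.smoothTransition.zero_of_nonpos this]
        exact (Real.exp_pos _).le
      · refine (Real.smoothTransition.le_one _).trans (Real.one_le_exp ?_)
        have : -(T / (2 * √(m * L))) + l * x = l * (x - T / 2) := by
          simp only [l]
          field_simp
          ring
        rw [this]
        exact mul_nonneg hl.le (by linarith))
  have hprod : ∏ k ∈ Finset.range m, ∫ ω, Real.exp (l * B k ω) ∂P ≤ Real.exp V := by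
    calc ∏ k ∈ Finset.range m, ∫ ω, Real.exp (l * B k ω) ∂P
        ≤ ∏ k ∈ Finset.range m, Real.exp (l ^ 2 * (V * L)) :=
          Finset.prod_le_prod (fun k _ => integral_nonneg fun ω => (Real.exp_pos _).le) fun k _ =>
            integral_exp_mul_le (mB k) (bB k) (h0 k) hl.le hlL
              ((h.shift (k * L)).integral_sum_sq_le hs hC L)
      _ = Real.exp V := by
          rw [Finset.prod_const, Finset.card_range, ← Real.exp_nat_mul]
          congr 1
          linear_combination V * hl2
  -- The `j`-th term of a block is separated from all earlier blocks by a gap `j`, so its covariance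
  -- with them decays like `(j + 1) ^ (-s)`.
  have hcov : ∑ k ∈ Finset.range m, ∫ ω, (∑ i ∈ Finset.range k, B i ω) * B k ω ∂P ≤
      m * (C * zetaSum s * ∑ j ∈ Finset.range L, ((j : ℝ) + 1) ^ (-s)) := by
    have : ∀ k ∈ Finset.range m, ∫ ω, (∑ i ∈ Finset.range k, B i ω) * B k ω ∂P ≤
        C * zetaSum s * ∑ j ∈ Finset.range L, ((j : ℝ) + 1) ^ (-s) := by
      intro k _
      simp_rw [hBsum, B, Finset.mul_sum]
      rw [integral_finsetSum]
      · exact Finset.sum_le_sum fun j _ => h.integral_sum_mul_le hs hC (k * L) j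
      · intro j _
        simp_rw [Finset.sum_mul]
        exact integrable_finsetSum _ fun i _ => h.integrable_mul _ _
    simpa using Finset.sum_le_sum this
  have hprob : P.real {ω | T ≤ ∑ i ∈ Finset.range (m * L), Y i ω} ≤
      ∫ ω, Real.smoothTransition (2 / T * ∑ k ∈ Finset.range m, B k ω - 1) ∂P := by
    have mS : Measurable fun ω => ∑ i ∈ Finset.range (m * L), Y i ω :=
      Finset.measurable_sum _ fun i _ => h.meas _
    have mset : MeasurableSet {ω | T ≤ ∑ i ∈ Finset.range (m * L), Y i ω} :=
      measurableSet_le measurable_const mS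
    rw [measureReal_eq_integral_indicator mset]
    simp_rw [hBsum]
    refine integral_mono_of_nonneg
      (ae_of_all _ fun ω => Set.indicator_nonneg (fun _ _ => zero_le_one) ω)
      (integrable_of_abs_le (R := 1)
        (Real.smoothTransition.continuous.measurable.comp ((mS.const_mul _).sub_const 1))
        fun ω => ?_) (ae_of_all _ fun ω => ?_)
    · rw [abs_of_nonneg (Real.smoothTransition.nonneg _)]
      exact Real.smoothTransition.le_one _
    · refine Set.indicator_apply_le' (fun hω => ?_) (fun _ => Real.smoothTransition.nonneg _)
      refine (Real.smoothTransition.one_of_one_le ?_).ge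
      have hω' : T ≤ ∑ i ∈ Finset.range (m * L), Y i ω := hω
      have : 2 / T * T ≤ 2 / T * ∑ i ∈ Finset.range (m * L), Y i ω := by gcongr
      rw [div_mul_cancel₀ _ hT.ne'] at this
      linarith
  refine hprob.trans (main.trans (add_le_add ?_ ?_))
  · rw [sub_eq_neg_add, Real.exp_add]
    gcongr
  · exact mul_le_mul_of_nonneg_left hcov (by positivity)

end Moments

/-! ### Summable bounds along dyadic times -/

/-- Induction on `L`. Bernoulli's inequality for the exponent `1 - s` at `-1 / (L + 1)` says that
the increment of `L ^ (1 - s)` is at least `(1 - s) * (L + 1) ^ (-s)`. -/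
theorem sum_range_rpow_neg_le {s : ℝ} (hs0 : 0 ≤ s) (hs1 : s < 1) (L : ℕ) :
    ∑ j ∈ Finset.range L, ((j : ℝ) + 1) ^ (-s) ≤ (L : ℝ) ^ (1 - s) / (1 - s) := by
  have h1 : 0 < 1 - s := by linarith
  rw [le_div_iff₀ h1]
  induction L with
  | zero => simp [Real.zero_rpow h1.ne']
  | succ L ih =>
    rw [Finset.sum_range_succ, add_mul]
    have hL : (0 : ℝ) < (L : ℝ) + 1 := by positivity
    have hb := rpow_one_add_le_one_add_mul_self (s := -1 / ((L : ℝ) + 1)) (p := 1 - s)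
      (by rw [le_div_iff₀ hL]; have : (0 : ℝ) ≤ L := Nat.cast_nonneg L; linarith) h1.le
      (by linarith)
    have e : 1 + -1 / ((L : ℝ) + 1) = L / ((L : ℝ) + 1) := by field_simp; ring
    rw [e, Real.div_rpow (Nat.cast_nonneg L) hL.le, div_le_iff₀ (by positivity)] at hb
    have e2 : ((L : ℝ) + 1) ^ (1 - s) = ((L : ℝ) + 1) * ((L : ℝ) + 1) ^ (-s) := by
      rw [sub_eq_add_neg, Real.rpow_add hL, Real.rpow_one]
    have e3 : (1 + (1 - s) * (-1 / ((L : ℝ) + 1))) * ((L : ℝ) + 1) ^ (1 - s) =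
        ((L : ℝ) + 1) ^ (1 - s) - (1 - s) * ((L : ℝ) + 1) ^ (-s) := by
      rw [e2]; field_simp; ring
    push_cast
    linarith

theorem summable_exp_neg_mul_rpow {c δ : ℝ} (hc : 0 < c) (hδ : 0 < δ) :
    Summable fun j : ℕ => Real.exp (-c * (j : ℝ) ^ δ) := by
  have h1 : (fun j : ℕ => Real.exp (-c * (j : ℝ) ^ δ)) =o[atTop]
      fun j : ℕ => ((j : ℝ) ^ δ) ^ (-2 / δ) :=
    (isLittleO_exp_neg_mul_rpow_atTop hc (-2 / δ)).comp_tendsto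
      ((tendsto_rpow_atTop hδ).comp tendsto_natCast_atTop_atTop)
  refine summable_of_isBigO_nat (g := fun j : ℕ => (j : ℝ) ^ (-2 : ℝ))
    (Real.summable_nat_rpow.2 (by norm_num)) (h1.isBigO.congr_right fun j => ?_)
  rw [← Real.rpow_mul (Nat.cast_nonneg j)]
  congr 1
  field_simp

theorem summable_rpow_neg_two_pow_div_three {s : ℝ} (hs : 0 < s) :
    Summable fun j : ℕ => ((2 : ℝ) ^ (j / 3)) ^ (-s) := by
  have hr : (2 : ℝ) ^ (-s / 3) < 1 := Real.rpow_lt_one_of_one_lt_of_neg one_lt_two (by linarith)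
  refine Summable.of_nonneg_of_le (fun j => by positivity) (fun j => ?_)
    ((summable_geometric_of_lt_one (by positivity) hr).mul_left ((2 : ℝ) ^ (2 * s / 3)))
  rw [← Real.rpow_natCast, ← Real.rpow_natCast, ← Real.rpow_mul zero_le_two,
    ← Real.rpow_mul zero_le_two, ← Real.rpow_add zero_lt_two]
  refine Real.rpow_le_rpow_of_exponent_le one_le_two ?_
  -- Rounding `j / 3` down loses at most `2 / 3`, which the constant `2 ^ (2 * s / 3)` absorbs.
  have h : (j : ℝ) ≤ 3 * ((j / 3 : ℕ) : ℝ) + 2 := by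
    exact_mod_cast (by omega : j ≤ 3 * (j / 3) + 2)
  nlinarith

/-- The maximal inequality followed by the block tail bound. The same `q` serves all `Y`, since the
indicators will be taken at a level that changes with `j`. -/
theorem IsWeaklyCorrelated.exists_summable_bound {Ω : Type*} [MeasurableSpace Ω] (P : Measure Ω)
    [IsProbabilityMeasure P] {C s a δ : ℝ} (hC : 0 ≤ C) (hs : 0 < s) (hs1 : s < 1) (ha : 0 < a)
    (hδ : 0 < δ) :
    ∃ q : ℕ → ℝ, Summable q ∧ ∀ᶠ j : ℕ in atTop, ∀ Y : ℕ → Ω → ℝ, IsWeaklyCorrelated Y P C s →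
      P.real {ω | a * (j : ℝ) ^ δ * √(2 ^ j) ≤ maxPartialSum Y (2 ^ j) 0 ω} ≤ q j := by
  obtain ⟨K, hK0, hK⟩ := exists_deriv_smoothTransition_sub_le
  have hZ := zetaSum_nonneg s
  set V := 1 + 2 * (C * zetaSum s)
  refine ⟨fun j => 2 * (Real.exp V * Real.exp (-(a / 4) * (j : ℝ) ^ δ) +
    16 * K * (C * zetaSum s) / (a ^ 2 * (1 - s)) * ((2 : ℝ) ^ (j / 3)) ^ (-s)),
    (((summable_exp_neg_mul_rpow (by positivity) hδ).mul_left _).add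
      ((summable_rpow_neg_two_pow_div_three hs).mul_left _)).mul_left _, ?_⟩
  have htend : Tendsto (fun j : ℕ => (j : ℝ) ^ δ) atTop atTop :=
    (tendsto_rpow_atTop hδ).comp tendsto_natCast_atTop_atTop
  -- Together these give `j ^ (2 δ) ≥ 32 V / a ^ 2`, the condition `32 * W ≤ T ^ 2` of the maximal
  -- inequality for `W = V * 2 ^ j`.
  filter_upwards [htend.eventually_ge_atTop 1, htend.eventually_ge_atTop (32 * V / a ^ 2)]
    with j hj1 hjV Y hY
  set d : ℝ := (j : ℝ) ^ δ
  have hd2 : d ≤ d ^ 2 := by nlinarith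
  have hd : 0 < d := by linarith
  have h2j : (0 : ℝ) < 2 ^ j := by positivity
  have hsq : √((2 : ℝ) ^ j) ^ 2 = 2 ^ j := Real.sq_sqrt h2j.le
  have hsqpos : 0 < √((2 : ℝ) ^ j) := Real.sqrt_pos.2 h2j
  have hT : 0 < a * d * √(2 ^ j) := by positivity
  have hmax := measureReal_maxPartialSum_ge_le hY.assoc hY.meas hY.bdd hY.mean (2 ^ j) 0 hT
    (W := V * 2 ^ j) (by simpa using hY.integral_sum_sq_le hs hC (2 ^ j)) (by
      rw [mul_pow, hsq, ← mul_assoc]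
      refine mul_le_mul_of_nonneg_right ?_ h2j.le
      rw [div_le_iff₀ (by positivity)] at hjV
      rw [mul_pow]
      nlinarith [sq_nonneg a])
  have hsplit : 2 ^ (j - j / 3) * 2 ^ (j / 3) = 2 ^ j := by
    rw [← pow_add]; congr 1; omega
  have hsplit' : (2 : ℝ) ^ (j - j / 3) * 2 ^ (j / 3) = 2 ^ j := by exact_mod_cast hsplit
  -- Blocks of length `2 ^ (j / 3)` satisfy `L ≤ m`, yet are long enough for the saving `L ^ (-s)`
  -- to be summable in `j`.
  have htail := hY.measureReal_sum_ge_le hs hC hK hK0 (m := 2 ^ (j - j / 3)) (L := 2 ^ (j / 3))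
    (by positivity) (by positivity) (Nat.pow_le_pow_right two_pos (by omega)) (half_pos hT)
  rw [hsplit] at htail
  simp only [zero_add] at hmax
  refine hmax.trans (mul_le_mul_of_nonneg_left (htail.trans (add_le_add ?_ ?_)) zero_le_two)
  · push_cast
    rw [hsplit', sub_eq_add_neg, Real.exp_add]
    refine le_of_eq ?_
    congr 2
    field_simp
    ring
  · have hw := sum_range_rpow_neg_le hs.le hs1 (2 ^ (j / 3))
    push_cast at hw ⊢
    set w := ∑ i ∈ Finset.range (2 ^ (j / 3)), ((i : ℝ) + 1) ^ (-s)
    set l : ℝ := 2 ^ (j / 3) with hl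
    have hl0 : 0 < l := by positivity
    rw [sub_eq_add_neg, Real.rpow_add hl0, Real.rpow_one] at hw
    have hm : (2 : ℝ) ^ (j - j / 3) = 2 ^ j / l := by rw [eq_div_iff hl0.ne', hsplit']
    have e : (a * d * √(2 ^ j) / 2) ^ 2 = a ^ 2 * d ^ 2 * 2 ^ j / 4 := by
      rw [div_pow, mul_pow, hsq]; ring
    rw [e, hm]
    calc 4 * K / (a ^ 2 * d ^ 2 * 2 ^ j / 4) * (2 ^ j / l * (C * zetaSum s * w))
        = 16 * K * (C * zetaSum s) / a ^ 2 * (w / l) * (1 / d ^ 2) := by field_simp; ring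
      _ ≤ 16 * K * (C * zetaSum s) / a ^ 2 * (l ^ (-s) / (1 - s)) * 1 := by
          have h1s : 0 < 1 - s := by linarith
          have hwl : w / l ≤ l ^ (-s) / (1 - s) := by
            rw [div_le_iff₀ hl0]
            refine hw.trans (le_of_eq ?_)
            ring
          have hd1 : 1 / d ^ 2 ≤ 1 := by rw [div_le_one (by positivity)]; linarith
          gcongr
      _ = 16 * K * (C * zetaSum s) / (a ^ 2 * (1 - s)) * l ^ (-s) := by
          have h1s : 1 - s ≠ 0 := by linarith
          field_simp

/-! ### Covariances of indicators -/

section Indicators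

variable {Ω : Type*} [MeasurableSpace Ω] {P : Measure Ω}

theorem IsDensity.measureReal_Ioc_le {f : ℝ → ℝ} {ν : Measure ℝ} [IsFiniteMeasure ν]
    (hf : IsDensity f ν) {M : ℝ} (hM : ∀ x, f x ≤ M) {x ε : ℝ} (hε : 0 ≤ ε) :
    ν.real (Set.Ioc x (x + ε)) ≤ M * ε := by
  have hM0 : 0 ≤ M := (hf.2.1 0).trans (hM 0)
  refine ENNReal.toReal_le_of_le_ofReal (by positivity) ?_
  rw [hf.2.2, withDensity_apply _ measurableSet_Ioc]
  calc ∫⁻ y in Set.Ioc x (x + ε), ENNReal.ofReal (f y)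
      ≤ ∫⁻ _ in Set.Ioc x (x + ε), ENNReal.ofReal M :=
        lintegral_mono fun y => ENNReal.ofReal_le_ofReal (hM y)
    _ = ENNReal.ofReal (M * ε) := by
        rw [setLIntegral_const, Real.volume_Ioc, add_sub_cancel_left, ENNReal.ofReal_mul hM0]

/-- The piecewise linear function equal to `0` on `(-∞, x]` and to `1` on `[x + ε, ∞)`. -/
noncomputable def ramp (x ε : ℝ) (y : ℝ) : ℝ := max 0 (min 1 ((y - x) / ε))

theorem ramp_nonneg (x ε y : ℝ) : 0 ≤ ramp x ε y := le_max_left _ _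

theorem ramp_le_one (x ε y : ℝ) : ramp x ε y ≤ 1 := max_le zero_le_one (min_le_left _ _)

theorem monotone_ramp (x : ℝ) {ε : ℝ} (hε : 0 < ε) : Monotone (ramp x ε) := fun y z h => by
  unfold ramp
  gcongr

/-- The ramp has slope at most `1 / ε`. Monotonicity of the difference lets association replace a
ramp by `y / ε` in a covariance, at the cost of an inequality. -/
theorem monotone_div_sub_ramp (x : ℝ) {ε : ℝ} (hε : 0 < ε) :
    Monotone fun y => y / ε - ramp x ε y := fun y z h => by
  have h1 : (y - x) / ε ≤ (z - x) / ε := by gcongr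
  have h2 : y / ε = (y - x) / ε + x / ε := by ring
  have h3 : z / ε = (z - x) / ε + x / ε := by ring
  simp only [ramp, h2, h3]
  grind

theorem ramp_le_indicator (x : ℝ) {ε : ℝ} (hε : 0 < ε) (y : ℝ) :
    ramp x ε y ≤ (Set.Ioi x).indicator (fun _ => (1 : ℝ)) y := by
  by_cases hy : y ∈ Set.Ioi x
  · rw [Set.indicator_of_mem hy]
    exact ramp_le_one x ε y
  · rw [Set.indicator_of_notMem hy]
    rw [Set.mem_Ioi, not_lt] at hy
    refine max_le le_rfl ((min_le_right _ _).trans ?_)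
    exact div_nonpos_of_nonpos_of_nonneg (by linarith) hε.le

theorem indicator_sub_ramp_le (x : ℝ) {ε : ℝ} (hε : 0 < ε) (y : ℝ) :
    (Set.Ioi x).indicator (fun _ => (1 : ℝ)) y - ramp x ε y ≤
      (Set.Ioc x (x + ε)).indicator (fun _ => (1 : ℝ)) y := by
  by_cases hy : y ∈ Set.Ioc x (x + ε)
  · rw [Set.indicator_of_mem hy, Set.indicator_of_mem (Set.mem_Ioi.2 hy.1)]
    linarith [ramp_nonneg x ε y]
  · rw [Set.indicator_of_notMem hy]
    by_cases hy' : y ∈ Set.Ioi x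
    · have h1 : x + ε < y := by
        by_contra h
        exact hy ⟨hy', not_lt.1 h⟩
      have h2 : 1 ≤ (y - x) / ε := by rw [le_div_iff₀ hε]; linarith
      rw [Set.indicator_of_mem hy', ramp, min_eq_left h2, max_eq_right zero_le_one, sub_self]
    · rw [Set.indicator_of_notMem hy']
      linarith [ramp_nonneg x ε y]

theorem measurable_ramp (x ε : ℝ) : Measurable (ramp x ε) := by
  unfold ramp
  fun_prop

variable [IsProbabilityMeasure P] {X : ℕ → Ω → ℝ}

/-- Covariance inequality for indicators of associated variables with a bounded density. -/
theorem AssociatedSeq.integral_indicator_mul_le (hX : AssociatedSeq X P) {U V : Ω → ℝ}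
    (hU : IncrOf X U) (hV : IncrOf X V) (mU : Measurable U) (mV : Measurable V)
    (hc : CovDefined U V P) {M ε : ℝ} (hε : 0 < ε) (x : ℝ)
    (dU : P.real (U ⁻¹' Set.Ioc x (x + ε)) ≤ M * ε)
    (dV : P.real (V ⁻¹' Set.Ioc x (x + ε)) ≤ M * ε) :
    ∫ ω, (Set.Ioi x).indicator (fun _ => (1 : ℝ)) (U ω) *
        (Set.Ioi x).indicator (fun _ => (1 : ℝ)) (V ω) ∂P -
      (∫ ω, (Set.Ioi x).indicator (fun _ => (1 : ℝ)) (U ω) ∂P) *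
        ∫ ω, (Set.Ioi x).indicator (fun _ => (1 : ℝ)) (V ω) ∂P ≤
      covariance U V P / ε ^ 2 + 2 * (M * ε) := by
  rw [covariance_eq_integral_mul_sub hc]
  obtain ⟨iU, iV, iUV⟩ := hc
  set I : ℝ → ℝ := (Set.Ioi x).indicator (fun _ => (1 : ℝ))
  have hI0 : ∀ y, 0 ≤ I y := fun y => Set.indicator_nonneg (fun _ _ => zero_le_one) y
  have hI1 : ∀ y, I y ≤ 1 := fun y => Set.indicator_apply_le' (fun _ => le_rfl) fun _ => zero_le_one
  have mI : Measurable I := measurable_const.indicator measurableSet_Ioi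
  have mr := measurable_ramp x ε
  have bI : ∀ y, |I y| ≤ 1 := fun y => abs_le.2 ⟨by linarith [hI0 y], hI1 y⟩
  have br : ∀ y, |ramp x ε y| ≤ 1 := fun y =>
    abs_le.2 ⟨by linarith [ramp_nonneg x ε y], ramp_le_one x ε y⟩
  have iIU : Integrable (fun ω => I (U ω)) P := integrable_of_abs_le (mI.comp mU) fun ω => bI _
  have iIV : Integrable (fun ω => I (V ω)) P := integrable_of_abs_le (mI.comp mV) fun ω => bI _
  have irU : Integrable (fun ω => ramp x ε (U ω)) P :=
    integrable_of_abs_le (mr.comp mU) fun ω => br _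
  have irV : Integrable (fun ω => ramp x ε (V ω)) P :=
    integrable_of_abs_le (mr.comp mV) fun ω => br _
  have iII : Integrable (fun ω => I (U ω) * I (V ω)) P :=
    integrable_of_abs_le (R := 1 * 1) ((mI.comp mU).mul (mI.comp mV)) fun ω => by
      rw [abs_mul]; exact mul_le_mul (bI _) (bI _) (abs_nonneg _) zero_le_one
  have irr : Integrable (fun ω => ramp x ε (U ω) * ramp x ε (V ω)) P :=
    integrable_of_abs_le (R := 1 * 1) ((mr.comp mU).mul (mr.comp mV)) fun ω => by
      rw [abs_mul]; exact mul_le_mul (br _) (br _) (abs_nonneg _) zero_le_one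
  have iUr : Integrable (fun ω => U ω * ramp x ε (V ω)) P :=
    iU.mul_bdd (c := 1) (mr.comp mV).aestronglyMeasurable (ae_of_all _ fun ω => br _)
  have iUr' : Integrable (fun ω => U ω / ε * ramp x ε (V ω)) P := by
    have : ∀ ω, U ω / ε * ramp x ε (V ω) = U ω * ramp x ε (V ω) / ε := fun ω => by ring
    simp_rw [this]
    exact iUr.div_const ε
  have iUV' : Integrable (fun ω => U ω / ε * (V ω / ε)) P := by
    have : ∀ ω, U ω / ε * (V ω / ε) = U ω * V ω / ε ^ 2 := fun ω => by field_simp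
    simp_rw [this]
    exact iUV.div_const _
  -- `U / ε` minus its ramp is increasing, hence nonnegatively correlated with the ramp of `V`; `h2`
  -- then does the same for `V`.
  have h1 : ∫ ω, ramp x ε (U ω) * ramp x ε (V ω) ∂P -
      (∫ ω, ramp x ε (U ω) ∂P) * ∫ ω, ramp x ε (V ω) ∂P ≤
      ∫ ω, U ω / ε * ramp x ε (V ω) ∂P - (∫ ω, U ω / ε ∂P) * ∫ ω, ramp x ε (V ω) ∂P := by
    have h := hX.integral_mul_integral_le (hU.comp (monotone_div_sub_ramp x hε))
      (hV.comp (monotone_ramp x hε)) ((iU.div_const ε).sub irU) irV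
      (by simp_rw [sub_mul]; exact iUr'.sub irr)
    simp_rw [sub_mul] at h
    rw [integral_sub (iU.div_const ε) irU, integral_sub iUr' irr, sub_mul] at h
    linarith
  have h2 : ∫ ω, U ω / ε * ramp x ε (V ω) ∂P - (∫ ω, U ω / ε ∂P) * ∫ ω, ramp x ε (V ω) ∂P ≤
      ∫ ω, U ω / ε * (V ω / ε) ∂P - (∫ ω, U ω / ε ∂P) * ∫ ω, V ω / ε ∂P := by
    have h := hX.integral_mul_integral_le (hU.comp (φ := fun y => y / ε)
      (fun y z hyz => div_le_div_of_nonneg_right hyz hε.le))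
      (hV.comp (monotone_div_sub_ramp x hε)) (iU.div_const ε) ((iV.div_const ε).sub irV)
      (by simp_rw [mul_sub]; exact iUV'.sub iUr')
    simp_rw [mul_sub] at h
    rw [integral_sub (iV.div_const ε) irV, integral_sub iUV' iUr', mul_sub] at h
    linarith
  have h3 : ∫ ω, U ω / ε * (V ω / ε) ∂P - (∫ ω, U ω / ε ∂P) * ∫ ω, V ω / ε ∂P =
      (∫ ω, U ω * V ω ∂P - (∫ ω, U ω ∂P) * ∫ ω, V ω ∂P) / ε ^ 2 := by
    have : ∀ ω, U ω / ε * (V ω / ε) = U ω * V ω / ε ^ 2 := fun ω => by field_simp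
    simp_rw [this, integral_div]
    field_simp
  have h4 : ∀ {W : Ω → ℝ}, Measurable W → P.real (W ⁻¹' Set.Ioc x (x + ε)) ≤ M * ε →
      ∫ ω, I (W ω) - ramp x ε (W ω) ∂P ≤ M * ε := by
    intro W mW dW
    refine le_trans ?_ dW
    rw [measureReal_eq_integral_indicator (mW measurableSet_Ioc)]
    exact integral_mono_of_nonneg
      (ae_of_all _ fun ω => sub_nonneg.2 (ramp_le_indicator x hε (W ω)))
      ((integrable_const _).indicator (mW measurableSet_Ioc))
      (ae_of_all _ fun ω => indicator_sub_ramp_le x hε (W ω))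
  have i5 : Integrable (fun ω => I (U ω) - ramp x ε (U ω)) P := iIU.sub irU
  have i6 : Integrable (fun ω => I (V ω) - ramp x ε (V ω)) P := iIV.sub irV
  have i7 : Integrable (fun ω => ramp x ε (U ω) * ramp x ε (V ω) +
      (I (U ω) - ramp x ε (U ω))) P := irr.add i5
  -- With `r` the ramp, `I U * I V - r U * r V = I U * (I V - r V) + r V * (I U - r U)`, and the
  -- factors `I U` and `r V` are at most `1`.
  have h5 : ∫ ω, I (U ω) * I (V ω) ∂P ≤ ∫ ω, (ramp x ε (U ω) * ramp x ε (V ω) +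
      (I (U ω) - ramp x ε (U ω))) + (I (V ω) - ramp x ε (V ω)) ∂P := by
    refine integral_mono iII (i7.add i6) fun ω => ?_
    have a1 := ramp_le_indicator x hε (U ω)
    have a2 := ramp_le_indicator x hε (V ω)
    have a3 := ramp_le_one x ε (V ω)
    have a4 := hI1 (U ω)
    change ramp x ε (U ω) ≤ I (U ω) at a1
    change ramp x ε (V ω) ≤ I (V ω) at a2
    simp only
    nlinarith [mul_nonneg (sub_nonneg.2 a4) (sub_nonneg.2 a2),
      mul_nonneg (sub_nonneg.2 a3) (sub_nonneg.2 a1)]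
  rw [integral_add i7 i6, integral_add irr i5] at h5
  have h6 : (∫ ω, ramp x ε (U ω) ∂P) * ∫ ω, ramp x ε (V ω) ∂P ≤
      (∫ ω, I (U ω) ∂P) * ∫ ω, I (V ω) ∂P :=
    mul_le_mul (integral_mono irU iIU fun ω => ramp_le_indicator x hε (U ω))
      (integral_mono irV iIV fun ω => ramp_le_indicator x hε (V ω))
      (integral_nonneg fun ω => ramp_nonneg _ _ _) (integral_nonneg fun ω => hI0 _)
  have h7 := h4 mU dU
  have h8 := h4 mV dV
  linarith

theorem StrictlyStationary.identDistrib {Ω : Type*} [MeasurableSpace Ω] {P : Measure Ω}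
    {X : ℕ → Ω → ℝ} (h : StrictlyStationary X P) (i : ℕ) :
    IdentDistrib (X i) (X 0) P P := by
  simpa [Function.comp_def] using (h i).comp (measurable_pi_apply 0)

theorem StrictlyStationary.integral_eq {Ω : Type*} [MeasurableSpace Ω] {P : Measure Ω}
    {X : ℕ → Ω → ℝ} (h : StrictlyStationary X P) {F : ℝ → ℝ → ℝ}
    (hF : Measurable (Function.uncurry F)) (i k : ℕ) :
    ∫ ω, F (X i ω) (X (i + k) ω) ∂P = ∫ ω, F (X 0 ω) (X k ω) ∂P := by
  have hm : Measurable fun v : ℕ → ℝ => F (v 0) (v k) :=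
    hF.comp (f := fun v : ℕ → ℝ => (v 0, v k))
      ((measurable_pi_apply 0).prodMk (measurable_pi_apply k))
  have := ((h i).comp hm).integral_eq
  simpa [Function.comp_def, add_comm k i] using this

theorem IsWeaklyCorrelated.neg {Y : ℕ → Ω → ℝ} {C s : ℝ} (h : IsWeaklyCorrelated Y P C s) :
    IsWeaklyCorrelated (fun i ω => -Y i ω) P C s where
  assoc := h.assoc.neg
  meas i := (h.meas i).neg
  bdd i ω := by simpa using h.bdd i ω
  mean i := by simp [integral_neg, h.mean]
  cov i k := by simpa using h.cov i k

/-- The centred indicators `P (X ≤ x) - 1 {X ≤ x}` inherit a polynomial covariance decay, uniformly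
in `x`. -/
theorem exists_isWeaklyCorrelated_indicator (hmeas : ∀ i, Measurable (X i))
    (hstat : StrictlyStationary X P) (hassoc : AssociatedSeq X P) {f : ℝ → ℝ}
    (hf : IsDensity f (P.map (X 0))) (hbdd : ∃ M : ℝ, ∀ x, f x ≤ M) {b : ℝ} (hb : 3 < b)
    (hdecay : CovDecay X P b) :
    ∃ C s : ℝ, 0 ≤ C ∧ 0 < s ∧ s < 1 ∧ ∀ x, IsWeaklyCorrelated
      (fun i ω => distFun (X 0) P x - Set.indicator {y : ℝ | y ≤ x} 1 (X i ω)) P C s := by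
  obtain ⟨M, hM⟩ := hbdd
  obtain ⟨b₀, hb₀, hcov⟩ := hdecay
  have hM0 : 0 ≤ M := (hf.2.1 0).trans (hM 0)
  have hprob : IsProbabilityMeasure (P.map (X 0)) :=
    Measure.isProbabilityMeasure_map (hmeas 0).aemeasurable
  -- The first entry of the minimum makes `1 + 2 s ≤ b / 3`, with `s > 0` because `b > 3`; the
  -- second keeps `s < 1`.
  refine ⟨b₀ + 2 * M, min ((b / 3 - 1) / 2) (1 / 2), by positivity,
    lt_min (by linarith) (by norm_num), (min_le_right _ _).trans_lt (by norm_num), fun x => ?_⟩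
  have hs : 1 + 2 * min ((b / 3 - 1) / 2) (1 / 2) ≤ b / 3 := by
    linarith [min_le_left ((b / 3 - 1) / 2) (1 / 2 : ℝ)]
  set q : ℝ := P.real {ω | x < X 0 ω}
  have hF : distFun (X 0) P x = 1 - q := by
    have h1 : {ω | X 0 ω ≤ x} = {ω | x < X 0 ω}ᶜ := by ext ω; simp
    rw [distFun, h1, probReal_compl_eq_one_sub (measurableSet_lt measurable_const (hmeas 0))]
  set I : ℝ → ℝ := (Set.Ioi x).indicator (fun _ => (1 : ℝ))
  have mI : Measurable I := measurable_const.indicator measurableSet_Ioi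
  -- Subtracting the indicator of `X ≤ x` from its mean gives the centred indicator of `X > x`,
  -- which is increasing in `X`.
  have eY : (fun (i : ℕ) (ω : Ω) => distFun (X 0) P x - Set.indicator {y : ℝ | y ≤ x} 1 (X i ω)) =
      fun i ω => I (X i ω) - q := by
    funext i ω
    rw [hF]
    by_cases h : X i ω ≤ x
    · simp [I, h, Set.indicator]
    · simp [I, h, Set.indicator, not_le.1 h]
  rw [eY]
  have hI0 : ∀ y, 0 ≤ I y := fun y => Set.indicator_nonneg (fun _ _ => zero_le_one) y
  have hI1 : ∀ y, I y ≤ 1 := fun y => Set.indicator_apply_le' (fun _ => le_rfl) fun _ => zero_le_one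
  have bI : ∀ y, |I y| ≤ 1 := fun y => abs_le.2 ⟨by linarith [hI0 y], hI1 y⟩
  have hq0 : 0 ≤ q := measureReal_nonneg
  have hq1 : q ≤ 1 := measureReal_le_one
  have monoI : Monotone I := by
    intro y z hyz
    by_cases hy : y ∈ Set.Ioi x
    · have hz : z ∈ Set.Ioi x := lt_of_lt_of_le hy hyz
      simp [I, hy, hz]
    · simpa [I, hy] using hI0 z
  have iI : ∀ i, Integrable (fun ω => I (X i ω)) P := fun i =>
    integrable_of_abs_le (mI.comp (hmeas i)) fun ω => bI _
  have EI : ∀ i, ∫ ω, I (X i ω) ∂P = q := by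
    intro i
    have h1 : ∫ ω, I (X i ω) ∂P = ∫ ω, I (X 0 ω) ∂P :=
      hstat.integral_eq (F := fun y _ => I y) (mI.comp measurable_fst) i 0
    rw [h1]
    exact (measureReal_eq_integral_indicator (measurableSet_lt measurable_const (hmeas 0))).symm
  refine ⟨hassoc.of_incrOf fun i => ?_, fun i => (mI.comp (hmeas i)).sub_const q, fun i ω => ?_,
    fun i => ?_, fun i k => ?_⟩
  · exact (IncrOf.coord X i).comp (φ := fun y => I y - q) fun y z h => sub_le_sub_right (monoI h) q
  · exact abs_le.2 ⟨by linarith [hI0 (X i ω)], by linarith [hI1 (X i ω)]⟩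
  · rw [integral_sub (iI i) (integrable_const _), EI]
    simp
  · have h1 : ∫ ω, (I (X i ω) - q) * (I (X (i + k + 1) ω) - q) ∂P =
        ∫ ω, (I (X 0 ω) - q) * (I (X (k + 1) ω) - q) ∂P :=
      hstat.integral_eq (F := fun y z => (I y - q) * (I z - q))
        (((mI.comp measurable_fst).sub_const q).mul ((mI.comp measurable_snd).sub_const q)) i (k + 1)
    have iII : Integrable (fun ω => I (X 0 ω) * I (X (k + 1) ω)) P :=
      integrable_of_abs_le (R := 1 * 1) ((mI.comp (hmeas 0)).mul (mI.comp (hmeas (k + 1))))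
        fun ω => by rw [abs_mul]; exact mul_le_mul (bI _) (bI _) (abs_nonneg _) zero_le_one
    have h2 : ∫ ω, (I (X 0 ω) - q) * (I (X (k + 1) ω) - q) ∂P =
        ∫ ω, I (X 0 ω) * I (X (k + 1) ω) ∂P - q * q := by
      have hd : CovDefined (fun ω => I (X 0 ω)) (fun ω => I (X (k + 1) ω)) P :=
        ⟨iI 0, iI (k + 1), iII⟩
      have := covariance_eq_integral_mul_sub hd
      rwa [covariance, EI, EI] at this
    have hk : (0 : ℝ) < (k : ℝ) + 1 := by positivity
    obtain ⟨hd, hle⟩ := hcov (k + 1) (by omega)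
    push_cast at hle
    have hlaw : ∀ i, P.real (X i ⁻¹' Set.Ioc x (x + ((k : ℝ) + 1) ^ (-(b / 3)))) ≤
        M * ((k : ℝ) + 1) ^ (-(b / 3)) := by
      intro i
      rw [← map_measureReal_apply (hmeas i) measurableSet_Ioc, (hstat.identDistrib i).map_eq]
      exact hf.measureReal_Ioc_le hM (by positivity)
    -- This `ε` balances the two errors: `(k + 1) ^ (-b) / ε ^ 2` and `ε` are both `(k + 1) ^ (-b /
    -- 3)`.
    have h3 := hassoc.integral_indicator_mul_le (IncrOf.coord X 0) (IncrOf.coord X (k + 1))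
      (hmeas 0) (hmeas (k + 1)) hd (M := M) (ε := ((k : ℝ) + 1) ^ (-(b / 3))) (by positivity) x
      (hlaw 0) (hlaw (k + 1))
    change ∫ ω, I (X 0 ω) * I (X (k + 1) ω) ∂P -
      (∫ ω, I (X 0 ω) ∂P) * ∫ ω, I (X (k + 1) ω) ∂P ≤ _ at h3
    rw [EI, EI] at h3
    rw [h1, h2]
    calc ∫ ω, I (X 0 ω) * I (X (k + 1) ω) ∂P - q * q
        ≤ covariance (X 0) (X (k + 1)) P / (((k : ℝ) + 1) ^ (-(b / 3))) ^ 2 +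
          2 * (M * ((k : ℝ) + 1) ^ (-(b / 3))) := h3
      _ ≤ b₀ * ((k : ℝ) + 1) ^ (-b) / (((k : ℝ) + 1) ^ (-(b / 3))) ^ 2 +
          2 * (M * ((k : ℝ) + 1) ^ (-(b / 3))) := by gcongr
      _ = (b₀ + 2 * M) * ((k : ℝ) + 1) ^ (-(b / 3)) := by
          have e : ((k : ℝ) + 1) ^ (-b) =
              ((k : ℝ) + 1) ^ (-(b / 3)) * (((k : ℝ) + 1) ^ (-(b / 3))) ^ 2 := by
            rw [← Real.rpow_natCast, ← Real.rpow_mul hk.le, ← Real.rpow_add hk]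
            congr 1
            push_cast
            ring
          rw [e, mul_div_assoc, mul_div_cancel_right₀ _ (by positivity)]
          ring
      _ ≤ (b₀ + 2 * M) * ((k : ℝ) + 1) ^ (-(1 + 2 * min ((b / 3 - 1) / 2) (1 / 2))) := by
          refine mul_le_mul_of_nonneg_left ?_ (by positivity)
          exact Real.rpow_le_rpow_of_exponent_le (by linarith [Nat.cast_nonneg (α := ℝ) k])
            (by linarith)

end Indicators

/-! ### Quantiles and sample quantiles -/

section Quantiles

theorem distFun_eq_cdf {Ω : Type*} [MeasurableSpace Ω] {P : Measure Ω} [IsProbabilityMeasure P]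
    {Y : Ω → ℝ} (hY : Measurable Y) (x : ℝ) : distFun Y P x = cdf (P.map Y) x := by
  have := Measure.isProbabilityMeasure_map (μ := P) hY.aemeasurable
  rw [cdf_eq_real, map_measureReal_apply hY measurableSet_Iic]
  rfl

/-- A distribution function which is continuous at its `p`-quantile takes the value `p` there. -/
theorem distFun_quantile_eq {Ω : Type*} [MeasurableSpace Ω] {P : Measure Ω}
    [IsProbabilityMeasure P] {Y : Ω → ℝ} (hY : Measurable Y) {p : ℝ} (hp0 : 0 < p) (hp1 : p < 1)
    (hc : ContinuousAt (distFun Y P) (quantile (distFun Y P) p)) :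
    distFun Y P (quantile (distFun Y P) p) = p := by
  have := Measure.isProbabilityMeasure_map (μ := P) hY.aemeasurable
  have hF : distFun Y P = cdf (P.map Y) := funext (distFun_eq_cdf hY)
  have mono : Monotone (distFun Y P) := hF ▸ monotone_cdf _
  set F := distFun Y P
  set ξ := quantile F p
  have hne : {x | p ≤ F x}.Nonempty := by
    have h1 : Tendsto F atTop (nhds 1) := hF ▸ tendsto_cdf_atTop _
    obtain ⟨x, hx⟩ := (h1.eventually (Ioi_mem_nhds hp1)).exists
    exact ⟨x, le_of_lt hx⟩
  have hbdd : BddBelow {x | p ≤ F x} := by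
    have h1 : Tendsto F atBot (nhds 0) := hF ▸ tendsto_cdf_atBot _
    obtain ⟨x, hx⟩ := (h1.eventually (Iio_mem_nhds hp0)).exists
    refine ⟨x, fun y hy => ?_⟩
    by_contra hyx
    exact absurd (mono (le_of_lt (not_le.1 hyx))) (not_le.2 (lt_of_lt_of_le hx hy))
  refine le_antisymm ?_ ?_
  -- To the left of `ξ` the values are below `p`, to the right at least `p`; continuity passes both
  -- to the limit.
  · refine le_of_tendsto (hc.tendsto.mono_left nhdsWithin_le_nhds : Tendsto F (nhdsWithin ξ (Set.Iio ξ)) _) ?_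
    filter_upwards [self_mem_nhdsWithin] with y hy
    by_contra h
    exact notMem_of_lt_csInf (s := {x | p ≤ F x}) hy hbdd (le_of_lt (not_le.1 h))
  · refine ge_of_tendsto (hc.tendsto.mono_left nhdsWithin_le_nhds : Tendsto F (nhdsWithin ξ (Set.Ioi ξ)) _) ?_
    filter_upwards [self_mem_nhdsWithin] with y hy
    obtain ⟨x, hx, hxy⟩ := exists_lt_of_csInf_lt hne hy
    exact le_trans hx (mono hxy.le)

variable {Ω : Type*} {X : ℕ → Ω → ℝ}

theorem monotone_empDistFun (X : ℕ → Ω → ℝ) (n : ℕ) (ω : Ω) : Monotone (empDistFun X n ω) := by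
  intro x y hxy
  refine mul_le_mul_of_nonneg_left (Finset.sum_le_sum fun i _ => ?_) (by positivity)
  exact Set.indicator_le_indicator_of_subset (fun z (hz : z ≤ x) => hz.trans hxy)
    (fun _ => zero_le_one) _

/-- With `nonempty_empDistFun_ge`, this ensures that the infimum defining the sample quantile is
genuine and not the default value `0` of `sInf`. -/
theorem bddBelow_empDistFun_ge {n : ℕ} {p : ℝ} (hp0 : 0 < p) (ω : Ω) :
    BddBelow {x | p ≤ empDistFun X n ω x} := by
  obtain ⟨m, hm⟩ := ((Finset.range n).finite_toSet.image fun i => X i ω).bddBelow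
  refine ⟨m, fun x hx => ?_⟩
  by_contra hxm
  have : empDistFun X n ω x = 0 := by
    rw [empDistFun, Finset.sum_eq_zero, mul_zero]
    intro i hi
    have h1 : m ≤ X i ω := hm ⟨i, hi, rfl⟩
    exact Set.indicator_of_notMem (s := {y : ℝ | y ≤ x}) (fun h2 => hxm (h1.trans h2)) 1
  rw [Set.mem_ofPred_eq, this] at hx
  linarith

theorem nonempty_empDistFun_ge {n : ℕ} (hn : 0 < n) {p : ℝ} (hp1 : p < 1) (ω : Ω) :
    {x | p ≤ empDistFun X n ω x}.Nonempty := by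
  obtain ⟨m, hm⟩ := ((Finset.range n).finite_toSet.image fun i => X i ω).bddAbove
  refine ⟨m, ?_⟩
  have : empDistFun X n ω m = 1 := by
    rw [empDistFun, Finset.sum_congr rfl (g := fun _ => (1 : ℝ))]
    · have : (n : ℝ) ≠ 0 := Nat.cast_ne_zero.2 hn.ne'
      simp [this]
    · intro i hi
      have h1 : X i ω ≤ m := hm ⟨i, hi, rfl⟩
      exact Set.indicator_of_mem (s := {y : ℝ | y ≤ m}) h1 1
  rw [Set.mem_ofPred_eq, this]
  exact hp1.le

/-- The sample quantile is within `r` of `ξ` as soon as the empirical distribution function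
separates `ξ - r` and `ξ + r` at the level `p`. -/
theorem abs_quantile_empDistFun_sub_le {n : ℕ} (hn : 0 < n) {p : ℝ} (hp0 : 0 < p) (hp1 : p < 1)
    {ω : Ω} {ξ r : ℝ} (h1 : p ≤ empDistFun X n ω (ξ + r)) (h2 : empDistFun X n ω (ξ - r) < p) :
    |quantile (empDistFun X n ω) p - ξ| ≤ r := by
  refine abs_sub_le_iff.2 ⟨?_, ?_⟩
  · have : quantile (empDistFun X n ω) p ≤ ξ + r := csInf_le (bddBelow_empDistFun_ge hp0 ω) h1
    linarith
  · have : ξ - r ≤ quantile (empDistFun X n ω) p := by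
      by_contra h
      obtain ⟨x, hx, hxr⟩ := exists_lt_of_csInf_lt (nonempty_empDistFun_ge hn hp1 ω) (not_le.1 h)
      exact absurd (lt_of_le_of_lt (hx.trans (monotone_empDistFun X n ω hxr.le)) h2) (lt_irrefl p)
    linarith

theorem sum_sub_indicator_eq {n : ℕ} (hn : 0 < n) (c x : ℝ) (ω : Ω) :
    ∑ i ∈ Finset.range n, (c - Set.indicator {y : ℝ | y ≤ x} 1 (X i ω)) =
      n * (c - empDistFun X n ω x) := by
  have : (n : ℝ) ≠ 0 := Nat.cast_ne_zero.2 hn.ne'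
  rw [Finset.sum_sub_distrib, empDistFun]
  simp
  field_simp

end Quantiles

/-! ### Borel–Cantelli, rates and conclusion -/

theorem ae_eventually_notMem_of_measureReal_le {Ω : Type*} [MeasurableSpace Ω] {P : Measure Ω}
    [IsFiniteMeasure P] {s : ℕ → Set Ω} {q : ℕ → ℝ} (hq : Summable q)
    (h : ∀ᶠ j in atTop, P.real (s j) ≤ q j) : ∀ᵐ ω ∂P, ∀ᶠ j in atTop, ω ∉ s j := by
  have hs : Summable fun j => P.real (s j) := by
    refine Summable.of_norm_bounded_eventually_nat hq ?_
    filter_upwards [h] with j hj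
    rwa [Real.norm_of_nonneg measureReal_nonneg]
  refine ae_eventually_notMem ?_
  have e : ∀ j, P (s j) = ENNReal.ofReal (P.real (s j)) := fun j => (ofReal_measureReal).symm
  simp_rw [e]
  exact hs.tsum_ofReal_ne_top

/-- The rate at the dyadic scale of `n` is dominated by the rate at `n`. -/
theorem rpow_log_div_sqrt_le {δ : ℝ} (hδ : 0 < δ) {n : ℕ} (hn : 2 ≤ n) :
    ((Nat.log 2 n + 1 : ℕ) : ℝ) ^ δ / √(2 ^ (Nat.log 2 n + 1)) ≤
      (2 / Real.log 2) ^ δ * ((n : ℝ) ^ (-(1 / 2 : ℝ)) * Real.log n ^ δ) := by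
  have hn0 : (0 : ℝ) < n := by positivity
  have hlog2 : 0 < Real.log 2 := Real.log_pos one_lt_two
  have h1 : (n : ℝ) ≤ 2 ^ (Nat.log 2 n + 1) := by
    exact_mod_cast (Nat.lt_pow_succ_log_self one_lt_two n).le
  have h2 : (2 : ℝ) ^ Nat.log 2 n ≤ n := by exact_mod_cast Nat.pow_log_le_self 2 (by omega)
  have h3 : (Nat.log 2 n : ℝ) * Real.log 2 ≤ Real.log n := by
    rw [← Real.log_pow]
    exact Real.log_le_log (by positivity) h2
  have h4 : 1 ≤ Nat.log 2 n := Nat.log_pos one_lt_two hn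
  have h5 : ((Nat.log 2 n + 1 : ℕ) : ℝ) ≤ 2 / Real.log 2 * Real.log n := by
    have h6 : (1 : ℝ) ≤ Nat.log 2 n := by exact_mod_cast h4
    push_cast
    rw [div_mul_eq_mul_div, le_div_iff₀ hlog2]
    nlinarith
  have hlogn : 0 ≤ Real.log n := Real.log_nonneg (by exact_mod_cast (by omega : 1 ≤ n))
  rw [Real.rpow_neg hn0.le, ← Real.sqrt_eq_rpow, div_eq_mul_inv]
  calc ((Nat.log 2 n + 1 : ℕ) : ℝ) ^ δ * (√(2 ^ (Nat.log 2 n + 1)))⁻¹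
      ≤ (2 / Real.log 2 * Real.log n) ^ δ * (√n)⁻¹ := by gcongr
    _ = (2 / Real.log 2) ^ δ * ((√n)⁻¹ * Real.log n ^ δ) := by
        rw [Real.mul_rpow (by positivity) hlogn]
        ring

theorem tendsto_rpow_div_sqrt_two_pow (δ : ℝ) :
    Tendsto (fun j : ℕ => (j : ℝ) ^ δ / √(2 ^ j)) atTop (nhds 0) := by
  have h := (isLittleO_rpow_exp_pos_mul_atTop δ (b := Real.log 2 / 2)
    (half_pos (Real.log_pos one_lt_two))).tendsto_div_nhds_zero.comp tendsto_natCast_atTop_atTop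
  refine h.congr fun j => ?_
  simp only [Function.comp_apply]
  congr 1
  rw [Real.sqrt_eq_rpow, ← Real.rpow_natCast, ← Real.rpow_mul zero_le_two,
    Real.rpow_def_of_pos zero_lt_two]
  congr 1
  ring

/-- A function with positive derivative at `ξ` moves at least linearly near `ξ`. -/
theorem HasDerivAt.exists_linear_bounds {F : ℝ → ℝ} {F' ξ : ℝ} (h : HasDerivAt F F' ξ)
    (hpos : 0 < F') : ∃ r₀ > 0, ∀ r, 0 < r → r < r₀ →
      F ξ + F' / 2 * r ≤ F (ξ + r) ∧ F (ξ - r) ≤ F ξ - F' / 2 * r := by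
  have h1 := (hasDerivAt_iff_isLittleO.1 h).bound (half_pos hpos)
  obtain ⟨r₀, hr₀, hball⟩ := Metric.eventually_nhds_iff.1 h1
  refine ⟨r₀, hr₀, fun r hr hrr => ?_⟩
  have a1 := hball (y := ξ + r) (by simpa [Real.dist_eq, abs_of_pos hr] using hrr)
  have a2 := hball (y := ξ - r) (by simpa [Real.dist_eq, abs_of_pos hr] using hrr)
  simp only [add_sub_cancel_left, sub_sub_cancel_left, smul_eq_mul, Real.norm_eq_abs, abs_neg,
    abs_of_pos hr] at a1 a2
  have b1 := abs_le.1 a1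
  have b2 := abs_le.1 a2
  constructor <;> linarith

theorem theorem1 {Ω : Type*} [MeasurableSpace Ω] (P : Measure Ω) [IsProbabilityMeasure P]
    (X : ℕ → Ω → ℝ) (hmeas : ∀ i, Measurable (X i))
    (hstat : StrictlyStationary X P) (hassoc : AssociatedSeq X P)
    (f : ℝ → ℝ) (hf : IsDensity f (P.map (X 0))) (hbdd : ∃ M : ℝ, ∀ x, f x ≤ M)
    (p : ℝ) (hp0 : 0 < p) (hp1 : p < 1)
    (hderiv : HasDerivAt (distFun (X 0) P) (f (quantile (distFun (X 0) P) p))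
      (quantile (distFun (X 0) P) p))
    (hpos : 0 < f (quantile (distFun (X 0) P) p))
    (b : ℝ) (hb : 3 < b) (hdecay : CovDecay X P b)
    (δ : ℝ) (hδ : 3 / (2 * b) < δ) :
    IsBigOAS
      (fun n ω => |quantile (empDistFun X n ω) p - quantile (distFun (X 0) P) p|)
      (fun n => (n : ℝ) ^ (-(1 / 2 : ℝ)) * Real.log (n : ℝ) ^ δ) P := by
  have hδ0 : 0 < δ := lt_trans (by positivity) hδ
  obtain ⟨C, s, hC, hs, hs1, hcorr⟩ :=
    exists_isWeaklyCorrelated_indicator hmeas hstat hassoc hf hbdd hb hdecay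
  have hFξ := distFun_quantile_eq (hmeas 0) hp0 hp1 hderiv.continuousAt
  obtain ⟨r₀, hr₀, hlin⟩ := hderiv.exists_linear_bounds hpos
  set F := distFun (X 0) P
  set ξ := quantile F p
  set κ := f ξ / 2 with hκ
  have hκ0 : 0 < κ := half_pos hpos
  set Y : ℝ → ℕ → Ω → ℝ := fun x i ω => F x - Set.indicator {y : ℝ | y ≤ x} 1 (X i ω)
  set r : ℕ → ℝ := fun j => (j : ℝ) ^ δ / √(2 ^ j)
  -- Here `κ = f ξ / 2` is the guaranteed slope of `F` near `ξ`; the further half pays for `2 ^ j ≤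
  -- 2 * n`.
  obtain ⟨q, hq, hqle⟩ := IsWeaklyCorrelated.exists_summable_bound P hC hs hs1
    (half_pos hκ0) hδ0
  have hup := ae_eventually_notMem_of_measureReal_le (P := P)
    (s := fun j => {ω | κ / 2 * (j : ℝ) ^ δ * √(2 ^ j) ≤
      maxPartialSum (Y (ξ + r j)) (2 ^ j) 0 ω}) hq
    (hqle.mono fun j hj => hj _ (hcorr (ξ + r j)))
  have hdown := ae_eventually_notMem_of_measureReal_le (P := P)
    (s := fun j => {ω | κ / 2 * (j : ℝ) ^ δ * √(2 ^ j) ≤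
      maxPartialSum (fun i ω => -Y (ξ - r j) i ω) (2 ^ j) 0 ω}) hq
    (hqle.mono fun j hj => hj _ (hcorr (ξ - r j)).neg)
  have hrsmall : ∀ᶠ j in atTop, r j < r₀ :=
    (tendsto_rpow_div_sqrt_two_pow δ).eventually (Iio_mem_nhds hr₀)
  have hlogtend : Tendsto (fun n : ℕ => Nat.log 2 n + 1) atTop atTop :=
    tendsto_atTop_atTop.2 fun j => ⟨2 ^ j, fun n hn =>
      (Nat.le_log_of_pow_le one_lt_two hn).trans (Nat.le_succ _)⟩
  filter_upwards [hup, hdown] with ω hω hω'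
  refine IsBigO.of_bound ((2 / Real.log 2) ^ δ) ?_
  filter_upwards [hlogtend.eventually (hω.and (hω'.and hrsmall)), eventually_ge_atTop 2]
    with n ⟨h1, h2, h3⟩ hn
  have hn0 : 0 < n := by omega
  have hrate := rpow_log_div_sqrt_le hδ0 hn
  have hnle : n ≤ 2 ^ (Nat.log 2 n + 1) := (Nat.lt_pow_succ_log_self one_lt_two n).le
  have hnge : (2 : ℝ) ^ (Nat.log 2 n + 1) ≤ 2 * n := by
    rw [pow_succ']
    have : (2 : ℝ) ^ Nat.log 2 n ≤ n := by exact_mod_cast Nat.pow_log_le_self 2 (by omega)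
    linarith
  -- The dyadic scale with `n ≤ 2 ^ j ≤ 2 * n`: the first bound puts the sum of `n` terms under the
  -- maximum, the second compares `n * r j` with `2 ^ j * r j`.
  set j := Nat.log 2 n + 1
  have hj0 : (0 : ℝ) < j := by positivity
  have hrj : 0 < r j := by positivity
  have hsq : (2 : ℝ) ^ j * r j = (j : ℝ) ^ δ * √(2 ^ j) := by
    have : (2 : ℝ) ^ j = √(2 ^ j) * √(2 ^ j) := (Real.mul_self_sqrt (by positivity)).symm
    simp only [r]
    nth_rewrite 1 [this]
    field_simp
  have hthr : κ / 2 * (j : ℝ) ^ δ * √(2 ^ j) ≤ n * (κ * r j) := by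
    rw [mul_assoc, ← hsq]
    nlinarith [mul_pos hκ0 hrj]
  obtain ⟨hF1, hF2⟩ := hlin (r j) hrj h3
  rw [hFξ] at hF1 hF2
  have hn' : (0 : ℝ) < n := Nat.cast_pos.2 hn0
  have hle : |quantile (empDistFun X n ω) p - ξ| ≤ r j := by
    refine abs_quantile_empDistFun_sub_le hn0 hp0 hp1 ?_ ?_
    -- `F (ξ + r j) ≥ p + κ * r j` while the empirical value is below `p`, so the centred sum is at
    -- least `n * κ * r j`, which exceeds the threshold excluded by `h1`. The other case is
    -- symmetric, with the negated sums.
    · by_contra hlt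
      refine h1 ?_
      refine le_trans ?_ (sum_le_maxPartialSum (Y := Y (ξ + r j)) (2 ^ j) 0 n hnle ω)
      simp only [Y, zero_add]
      rw [sum_sub_indicator_eq hn0]
      exact hthr.trans (mul_le_mul_of_nonneg_left (by linarith [not_le.1 hlt]) hn'.le)
    · by_contra hge
      refine h2 ?_
      refine le_trans ?_ (sum_le_maxPartialSum (Y := fun i ω => -Y (ξ - r j) i ω) (2 ^ j) 0 n hnle ω)
      simp only [Y, zero_add, Finset.sum_neg_distrib]
      rw [sum_sub_indicator_eq hn0, ← mul_neg]
      exact hthr.trans (mul_le_mul_of_nonneg_left (by linarith [not_lt.1 hge]) hn'.le)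
  rw [Real.norm_eq_abs, abs_abs, Real.norm_of_nonneg]
  · exact hle.trans hrate
  · have : 0 ≤ Real.log n := Real.log_nonneg (by exact_mod_cast (by omega : 1 ≤ n))
    positivity
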